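/- Let $\mathcal H_m=\ell^2(\mathbb N^m)$ be the Hilbert space of $m$ bosonic modes with Fock basis $(|\boldsymbol n\rangle)_{\boldsymbol n\in\mathbb N^m}$. The stellar function of a unit vector $\psi=\sum_{\boldsymbol n}\psi_{\boldsymbol n}|\boldsymbol n\rangle$ is $F^\star_\psi(\boldsymbol z)=\sum_{\boldsymbol n}\frac{\psi_{\boldsymbol n}}{\sqrt{\boldsymbol n!}}\boldsymbol z^{\boldsymbol n}$, $\boldsymbol z\in\mathbb C^m$. The stellar rank $r^\star(\psi)\in\mathbb N\cup\{\infty\}$ is $\deg P$ if $F^\star_\psi(\boldsymbol z)=P(\boldsymbol z)\,e^{\frac12\boldsymbol z^TA\boldsymbol z+\boldsymbol b^T\boldsymbol z}$ for some polynomial $P$, symmetric matrix $A\in\mathbb C^{m\times m}$ and $\boldsymbol b\in\mathbb C^m$, and $\infty$ if there is no such representation. For a density operator $\rho$ on $\mathcal H_m$, $$r^\star(\rho)=\inf_\mu\ \operatorname*{ess\,sup}_{\psi\sim\mu}\ r^\star(\psi),$$ where the infimum is over all decompositions of $\rho$ as a (discrete or continuous) mixture of pure states, i.e. over the Borel probability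 measures $\mu$ on the unit sphere of $\mathcal H_m$ with $\rho=\int|\psi\rangle\langle\psi|\,d\mu(\psi)$. With the fidelity $F(\rho,\tau)=\big(\operatorname{Tr}\sqrt{\sqrt\rho\,\tau\sqrt\rho}\big)^2$, the $\epsilon$-approximate stellar rank ($0\le\epsilon\le1$) and the stellar fidelities ($n\in\mathbb N$) of $\rho$ are $$r^\star_\epsilon(\rho)=\inf_{\tau:\,F(\rho,\tau)\ge1-\epsilon}r^\star(\tau),\qquad f^\star_n(\rho)=\sup_{\tau:\,r^\star(\tau)\le n}F(\rho,\tau),$$ with $\tau$ ranging over the density operators on $\mathcal H_m$. **Lemma (Equivalence between approximate stellar rank and stellar fidelities).** Let $\rho$ be an $m$-mode density operator. For all $n\in\mathbb N$ and all $0\le\epsilon\le1$, $$r^\star_\epsilon(\rho)\le n\iff1-\epsilon\le f^\star_n(\rho).$$ Equivalently, $\epsilon\mapsto r^\star_\epsilon(\rho)$ is the following step function: for all $0\le\epsilon\le1$, * if $1\le r^\star(\rho)<\infty$, then $r^\star_\epsilon(\rho)=r^\star(\rho)$ if and only if $\epsilon\in[0,\,1-f^\star_{r^\star(\rho)-1}(\rho))$;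 * for every $n\ge1$, $r^\star_\epsilon(\rho)=n$ if and only if $\epsilon\in[1-f^\star_n(\rho),\,1-f^\star_{n-1}(\rho))$; * $r^\star_\epsilon(\rho)=0$ if and only if $\epsilon\in[1-f^\star_0(\rho),\,1]$. -/

import Mathlib

open MeasureTheory
open scoped InnerProductSpace

noncomputable section

/-- The Hilbert space of `m` bosonic modes in the Fock (photon number) representation:
square-summable families of complex amplitudes indexed by `n = (n₁, …, nₘ) ∈ ℕᵐ`. -/
def FockSpace (m : ℕ) : Type := lp (fun _ : Fin m → ℕ => ℂ) 2

instance instNormedAddCommGroupFockSpace (m : ℕ) : NormedAddCommGroup (FockSpace m) :=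
  inferInstanceAs (NormedAddCommGroup (lp (fun _ : Fin m → ℕ => ℂ) 2))

instance instInnerProductSpaceFockSpace (m : ℕ) : InnerProductSpace ℂ (FockSpace m) :=
  inferInstanceAs (InnerProductSpace ℂ (lp (fun _ : Fin m → ℕ => ℂ) 2))

instance instCompleteSpaceFockSpace (m : ℕ) : CompleteSpace (FockSpace m) :=
  inferInstanceAs (CompleteSpace (lp (fun _ : Fin m → ℕ => ℂ) 2))

/-- Bounded operators on the `m`-mode Fock space. -/
abbrev FockOp (m : ℕ) : Type := FockSpace m →L[ℂ] FockSpace m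

/-- The Borel σ-algebra of the norm topology on the Fock space. -/
instance instMeasurableSpaceFockSpace (m : ℕ) : MeasurableSpace (FockSpace m) :=
  borel (FockSpace m)

instance instBorelSpaceFockSpace (m : ℕ) : BorelSpace (FockSpace m) := ⟨rfl⟩

/-- The Fock basis state `|n⟩`. -/
def fockState {m : ℕ} (n : Fin m → ℕ) : FockSpace m :=
  (lp.single 2 n (1 : ℂ) : lp (fun _ : Fin m → ℕ => ℂ) 2)

/-- `ρ` is a density operator: positive, with diagonal in the Fock basis summing to `1`. -/
def IsDensityOperator {m : ℕ} (ρ : FockOp m) : Prop :=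
  ρ.IsPositive ∧ HasSum (fun n : Fin m → ℕ => ⟪fockState n, ρ (fockState n)⟫_ℂ) 1

/-- The trace `∑ₙ ⟨n|A|n⟩` of a positive trace class operator `A`. -/
def posTrace {m : ℕ} (A : FockOp m) : ℝ :=
  ∑' n : Fin m → ℕ, (⟪fockState n, A (fockState n)⟫_ℂ).re

/-- The fidelity `F(ρ, τ) = Tr(√(√ρ τ √ρ))²`. -/
def fidelity {m : ℕ} (ρ τ : FockOp m) : ℝ :=
  posTrace (CFC.sqrt (CFC.sqrt ρ * τ * CFC.sqrt ρ)) ^ 2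

/-- The stellar (Bargmann) function `z ↦ ∑ₙ ψₙ / √(n!) zⁿ`, with `ψₙ = ⟨n|ψ⟩`,
`n! = ∏ⱼ nⱼ!` and `zⁿ = ∏ⱼ zⱼ ^ nⱼ`. The series converges absolutely for every `z`. -/
def stellarFunction {m : ℕ} (ψ : FockSpace m) (z : Fin m → ℂ) : ℂ :=
  ∑' n : Fin m → ℕ,
    ⟪fockState n, ψ⟫_ℂ / (Real.sqrt (∏ j, ((n j).factorial : ℝ)) : ℂ) * ∏ j, z j ^ n j

/-- The multivariate Gaussian function `z ↦ exp(½ zᵀ A z + bᵀ z)`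
(constant factors are absorbed in the polynomial multiplying it). -/
def gaussianFunction {m : ℕ} (A : Matrix (Fin m) (Fin m) ℂ) (b : Fin m → ℂ)
    (z : Fin m → ℂ) : ℂ :=
  Complex.exp ((1 / 2) * (∑ i, ∑ j, z i * A i j * z j) + ∑ j, b j * z j)

/-- The stellar function of `ψ` is the product of the polynomial `P` and a Gaussian function. -/
def HasStellarPolynomial {m : ℕ} (ψ : FockSpace m) (P : MvPolynomial (Fin m) ℂ) : Prop :=
  ∃ (A : Matrix (Fin m) (Fin m) ℂ) (b : Fin m → ℂ), A.IsSymm ∧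
    ∀ z : Fin m → ℂ, stellarFunction ψ z = MvPolynomial.eval z P * gaussianFunction A b z

/-- The stellar rank of a pure state `ψ`: the degree of `P` if the stellar function of `ψ` is
`P × G` with `P` a polynomial and `G` a Gaussian function (`P` is then unique up to a nonzero
constant factor), and `∞` if there is no such `P`. -/
def pureStellarRank {m : ℕ} (ψ : FockSpace m) : ℕ∞ :=
  ⨅ (P : MvPolynomial (Fin m) ℂ) (_ : HasStellarPolynomial ψ P), (P.totalDegree : ℕ∞)

/-- `ρ` is the mixture `∫ |ψ⟩⟨ψ| dμ(ψ)` of pure states (unit vectors) according to the probability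
measure `μ`; the integral is taken in the weak sense. A purely atomic `μ` gives a discrete
decomposition `ρ = ∑ᵢ pᵢ |ψᵢ⟩⟨ψᵢ|`. -/
structure IsPureDecomposition {m : ℕ} (μ : Measure (FockSpace m)) (ρ : FockOp m) : Prop where
  isProbabilityMeasure : IsProbabilityMeasure μ
  norm_eq_one : ∀ᵐ ψ ∂μ, ‖ψ‖ = 1
  inner_eq : ∀ x y : FockSpace m, ⟪x, ρ y⟫_ℂ = ∫ ψ, ⟪x, ψ⟫_ℂ * ⟪ψ, y⟫_ℂ ∂μ

/-- The stellar rank of a state `ρ` (convex roof): the infimum, over all decompositions of `ρ` as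
a mixture of pure states, of the essential supremum of the stellar ranks of the pure states that
occur in the mixture. -/
def stellarRank {m : ℕ} (ρ : FockOp m) : ℕ∞ :=
  ⨅ (μ : Measure (FockSpace m)) (_ : IsPureDecomposition μ ρ), essSup pureStellarRank μ

/-- The `ε`-approximate stellar rank: the infimum of the stellar ranks of the density operators
`τ` with `F(ρ, τ) ≥ 1 - ε`. -/
def approxStellarRank {m : ℕ} (ε : ℝ) (ρ : FockOp m) : ℕ∞ :=
  ⨅ (τ : FockOp m) (_ : IsDensityOperator τ ∧ 1 - ε ≤ fidelity ρ τ), stellarRank τ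

/-- The `n`-th stellar fidelity: the supremum of the fidelities of `ρ` with the density operators
of stellar rank at most `n`. -/
def stellarFidelity {m : ℕ} (n : ℕ) (ρ : FockOp m) : ℝ :=
  sSup {x : ℝ | ∃ τ : FockOp m, IsDensityOperator τ ∧ stellarRank τ ≤ n ∧ fidelity ρ τ = x}

end

noncomputable section

open Filter Topology Metric

/-! Everything reduces to one fact: the supremum defining the stellar fidelity is attained. Then
`approxStellarRank_le_iff` follows from the definitions, and the step-function statements are order
arithmetic.

Attainment is a compactness argument. The vectors of norm at most one and stellar rank at most `n`
form a weakly compact set: Banach–Alaoglu, plus closedness under weak limits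
(`pureStellarRank_le_of_tendsto`). For the latter, weak convergence is pointwise convergence of
stellar functions. Near a point where the limit is nonzero the approximants `P_i exp(g_i)` have no
zeros, so polynomial root bounds and Borel–Carathéodory control `P_i` and `g_i` separately. Both
live in fixed finite-dimensional spaces, hence converge.

Decompositions of a maximising sequence of states become probability measures on this compact set,
and they converge along an ultrafilter. Mass may escape, so the limit mixture is only `t • σ` with
`0 ≤ t ≤ 1`. For `t > 0`, `σ` is a state of rank at most `n` (`exists_density_smul_eq`). Fidelity
with `ρ` is weakly upper semicontinuous (`le_mul_fidelity_of_tendsto`), because `√ρ` is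
Hilbert–Schmidt and the trace tails are uniformly small, and it is linear under scaling. So the
limit fidelity is at most `t F(ρ, σ) ≤ F(ρ, σ)`. -/

/-! ### Stellar functions as inner products with coherent states. -/

/-- The Fock basis as a Hilbert basis. -/
def fockBasis (m : ℕ) : HilbertBasis (Fin m → ℕ) ℂ (FockSpace m) :=
  HilbertBasis.ofRepr (LinearIsometryEquiv.refl ℂ (lp (fun _ : Fin m → ℕ => ℂ) 2))

lemma fockBasis_apply {m : ℕ} (n : Fin m → ℕ) : fockBasis m n = fockState n := by
  rw [← HilbertBasis.repr_symm_single]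
  rfl

/-- Enclosing the finite index set in a box makes the sum factor into truncated exponential series.
-/
lemma sum_prod_pow_div_factorial_le {m : ℕ} (x : Fin m → ℝ) (hx : ∀ j, 0 ≤ x j)
    (s : Finset (Fin m → ℕ)) :
    ∑ n ∈ s, ∏ j, x j ^ n j / ((n j).factorial : ℝ) ≤ ∏ j, Real.exp (x j) := by
  classical
  let N := s.sup (fun n => Finset.univ.sup n) + 1
  have hs : s ⊆ Fintype.piFinset (fun _ : Fin m => Finset.range N) := by
    intro n hn
    rw [Fintype.mem_piFinset]
    intro j
    rw [Finset.mem_range, Nat.lt_succ_iff]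
    exact (Finset.le_sup (f := n) (Finset.mem_univ j)).trans
      (Finset.le_sup (f := fun n : Fin m → ℕ => Finset.univ.sup n) hn)
  have h0 : ∀ j k, 0 ≤ x j ^ k / (k.factorial : ℝ) := fun j k => by
    have := hx j; positivity
  calc _ ≤ ∑ n ∈ Fintype.piFinset (fun _ : Fin m => Finset.range N),
        ∏ j, x j ^ n j / ((n j).factorial : ℝ) :=
        Finset.sum_le_sum_of_subset_of_nonneg hs
          (fun n _ _ => Finset.prod_nonneg fun j _ => h0 j (n j))
    _ = ∏ j, ∑ k ∈ Finset.range N, x j ^ k / (k.factorial : ℝ) :=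
        (Finset.prod_univ_sum _ (fun j k => x j ^ k / (k.factorial : ℝ))).symm
    _ ≤ _ := Finset.prod_le_prod (fun j _ => Finset.sum_nonneg fun k _ => h0 j k)
        (fun j _ => Real.sum_le_exp_of_nonneg (hx j) N)

/-- Coefficients of the (unnormalised) coherent state whose inner product with `ψ` is the value
of the stellar function of `ψ` at `z`. -/
def coherentCoeff {m : ℕ} (z : Fin m → ℂ) (n : Fin m → ℕ) : ℂ :=
  (starRingEnd ℂ) ((∏ j, z j ^ n j) / (Real.sqrt (∏ j, ((n j).factorial : ℝ)) : ℂ))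

lemma norm_coherentCoeff_sq {m : ℕ} (z : Fin m → ℂ) (n : Fin m → ℕ) :
    ‖coherentCoeff z n‖ ^ 2 = ∏ j, (‖z j‖ ^ 2) ^ n j / ((n j).factorial : ℝ) := by
  have h : (0 : ℝ) ≤ ∏ j, ((n j).factorial : ℝ) := Finset.prod_nonneg fun j _ => by positivity
  rw [coherentCoeff, RCLike.norm_conj, norm_div, div_pow, Complex.norm_real, Real.norm_eq_abs,
    sq_abs, Real.sq_sqrt h, norm_prod, ← Finset.prod_pow, Finset.prod_div_distrib]
  congr 1
  refine Finset.prod_congr rfl fun j _ => ?_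
  rw [norm_pow, ← pow_mul, ← pow_mul, mul_comm]

lemma summable_coherentCoeff {m : ℕ} (z : Fin m → ℂ) :
    Summable fun n => ‖coherentCoeff z n‖ ^ 2 := by
  refine summable_of_sum_le (fun n => by positivity) (c := ∏ j, Real.exp (‖z j‖ ^ 2)) fun s => ?_
  simp_rw [norm_coherentCoeff_sq]
  exact sum_prod_pow_div_factorial_le _ (fun j => by positivity) s

/-- The unnormalised coherent state. -/
def coherentState {m : ℕ} (z : Fin m → ℂ) : FockSpace m :=
  (⟨coherentCoeff z, memℓp_gen (by
    simpa using summable_coherentCoeff z)⟩ : lp (fun _ : Fin m → ℕ => ℂ) 2)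

lemma inner_fockState_left {m : ℕ} (n : Fin m → ℕ) (ψ : FockSpace m) :
    ⟪fockState n, ψ⟫_ℂ = (show lp (fun _ : Fin m → ℕ => ℂ) 2 from ψ) n := by
  refine (lp.inner_single_left (𝕜 := ℂ) (G := fun _ : Fin m → ℕ => ℂ) n (1 : ℂ) _).trans ?_
  simp

/-- This turns weak convergence of vectors into pointwise convergence of stellar functions. -/
lemma stellarFunction_eq_inner {m : ℕ} (ψ : FockSpace m) (z : Fin m → ℂ) :
    stellarFunction ψ z = ⟪coherentState z, ψ⟫_ℂ := by
  refine Eq.trans ?_ (lp.inner_eq_tsum (𝕜 := ℂ) (G := fun _ : Fin m → ℕ => ℂ) _ _).symm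
  refine tsum_congr fun n => ?_
  rw [inner_fockState_left]
  change _ = ⟪coherentCoeff z n, _⟫_ℂ
  rw [coherentCoeff, RCLike.inner_apply, RingHomCompTriple.comp_apply, RingHom.id_apply]
  ring

lemma norm_coherentState_sq_le {m : ℕ} (z : Fin m → ℂ) :
    ‖coherentState z‖ ^ 2 ≤ ∏ j, Real.exp (‖z j‖ ^ 2) := by
  have h : HasSum (fun n => ‖coherentCoeff z n‖ ^ 2) (‖coherentState z‖ ^ 2) := by
    have := lp.hasSum_norm (p := 2) (E := fun _ : Fin m → ℕ => ℂ) (by norm_num) (coherentState z)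
    simp only [ENNReal.toReal_ofNat, Real.rpow_ofNat] at this
    exact this
  refine hasSum_le_of_sum_le h fun s => ?_
  simp_rw [norm_coherentCoeff_sq]
  exact sum_prod_pow_div_factorial_le _ (fun j => by positivity) s

lemma norm_stellarFunction_le {m : ℕ} {ψ : FockSpace m} (hψ : ‖ψ‖ ≤ 1) {R : ℝ} {z : Fin m → ℂ}
    (hz : ‖z‖ ≤ R) : ‖stellarFunction ψ z‖ ≤ Real.sqrt (Real.exp (R ^ 2) ^ m) := by
  rw [stellarFunction_eq_inner]
  refine (norm_inner_le_norm _ _).trans ?_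
  refine (mul_le_of_le_one_right (norm_nonneg _) hψ).trans ?_
  refine Real.le_sqrt_of_sq_le ((norm_coherentState_sq_le z).trans ?_)
  refine (Finset.prod_le_prod (fun j _ => (Real.exp_pos _).le) (g := fun _ => Real.exp (R ^ 2))
    fun j _ => ?_).trans (by simp)
  have := (norm_le_pi_norm z j).trans hz
  gcongr

/-! ### Zero-free polynomials and finite-dimensional function spaces. -/

/-- A polynomial of degree at most `n` without zeros in the disc of
radius `R` is bounded there by `2 ^ n |p 0|`. -/
lemma Polynomial.norm_eval_le_of_forall_ne_zero {p : Polynomial ℂ} {n : ℕ} (hp : p.natDegree ≤ n)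
    {R : ℝ} (hR : ∀ t : ℂ, ‖t‖ < R → p.eval t ≠ 0) {t : ℂ} (ht : ‖t‖ < R) :
    ‖p.eval t‖ ≤ 2 ^ n * ‖p.eval 0‖ := by
  have hs := IsAlgClosed.splits p
  have key : ∀ s : Multiset ℂ, (∀ a ∈ s, R ≤ ‖a‖) →
      ‖(s.map (fun a => t - a)).prod‖ ≤ 2 ^ s.card * ‖(s.map (fun a => 0 - a)).prod‖ := by
    intro s
    induction s using Multiset.induction with
    | empty => simp
    | cons a s ih =>
      intro h
      have h1 := ih fun b hb => h b (Multiset.mem_cons_of_mem hb)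
      have h2 : ‖t - a‖ ≤ 2 * ‖0 - a‖ := by
        have := h a (Multiset.mem_cons_self a s)
        have := norm_sub_le t a
        rw [zero_sub, norm_neg]; linarith
      simp only [Multiset.map_cons, Multiset.prod_cons, Multiset.card_cons, norm_mul]
      calc _ ≤ (2 * ‖0 - a‖) * (2 ^ s.card * ‖(s.map (fun a => 0 - a)).prod‖) := by gcongr
        _ = _ := by ring
  have hroot : ∀ a ∈ p.roots, R ≤ ‖a‖ := fun a ha => by
    by_contra! h
    exact hR a h (Polynomial.isRoot_of_mem_roots ha)
  rw [hs.eval_eq_prod_roots t, hs.eval_eq_prod_roots 0, norm_mul, norm_mul]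
  have hc : (2 : ℝ) ^ p.roots.card ≤ 2 ^ n :=
    pow_le_pow_right₀ (by norm_num) (p.card_roots'.trans hp)
  calc _ ≤ ‖p.leadingCoeff‖ * (2 ^ p.roots.card * ‖(p.roots.map (fun a => 0 - a)).prod‖) := by
        gcongr; exact key _ hroot
    _ ≤ ‖p.leadingCoeff‖ * (2 ^ n * ‖(p.roots.map (fun a => 0 - a)).prod‖) := by gcongr
    _ = _ := by ring

/-- Recentre the previous bound at `t`: the disc of radius `R / 2` around `t` is still zero-free and
contains the origin. -/
lemma Polynomial.norm_eval_zero_le_of_forall_ne_zero {p : Polynomial ℂ} {n : ℕ}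
    (hp : p.natDegree ≤ n) {R : ℝ} (hR : ∀ t : ℂ, ‖t‖ < R → p.eval t ≠ 0) {t : ℂ}
    (ht : 2 * ‖t‖ < R) : ‖p.eval 0‖ ≤ 2 ^ n * ‖p.eval t‖ := by
  have := Polynomial.norm_eval_le_of_forall_ne_zero (p := p.comp (Polynomial.X + Polynomial.C t))
    (n := n) (R := R / 2) (t := -t) ?_ ?_ ?_
  · simpa using this
  · simpa [Polynomial.natDegree_comp] using hp
  · intro s hs
    rw [Polynomial.eval_comp]
    refine hR _ ?_
    have := norm_add_le s t
    simp only [Polynomial.eval_add, Polynomial.eval_X, Polynomial.eval_C]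
    linarith
  · rw [norm_neg]; linarith

/-- The restriction of a multivariate polynomial to the line `t ↦ z + t v`. -/
lemma MvPolynomial.exists_polynomial_line {m n : ℕ} {P : MvPolynomial (Fin m) ℂ}
    (hP : P.totalDegree ≤ n) (z v : Fin m → ℂ) :
    ∃ p : Polynomial ℂ, p.natDegree ≤ n ∧
      ∀ t : ℂ, p.eval t = MvPolynomial.eval (z + t • v) P := by
  refine ⟨MvPolynomial.aeval (fun j => Polynomial.C (z j) + Polynomial.X * Polynomial.C (v j)) P,
    ?_, fun t => ?_⟩
  · have := MvPolynomial.aeval_natDegree_le P hP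
      (fun j => Polynomial.C (z j) + Polynomial.X * Polynomial.C (v j)) (n := 1) fun j => by
        compute_degree
    simpa using this
  · rw [← Polynomial.coe_evalRingHom, MvPolynomial.aeval_def, MvPolynomial.hom_eval₂,
      MvPolynomial.eval, MvPolynomial.coe_eval₂Hom]
    congr 1
    · ext; simp
    · ext j; simp; ring

lemma MvPolynomial.eq_zero_of_forall_closedBall {m : ℕ} {P : MvPolynomial (Fin m) ℂ}
    {z : Fin m → ℂ} {r : ℝ} (hr : 0 < r) (h : ∀ w ∈ closedBall z r, MvPolynomial.eval w P = 0) :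
    P = 0 := by
  refine MvPolynomial.funext_set (fun j => closedBall (z j) r) (fun j => ?_) fun x hx => ?_
  · refine infinite_of_mem_nhds (z j) (closedBall_mem_nhds _ hr)
  · rw [map_zero]
    refine h x ?_
    rw [mem_closedBall, dist_pi_le_iff hr.le]
    intro j
    exact hx j (Set.mem_univ j)

/-- Pointwise bounded nets in a finite-dimensional space of functions converge pointwise along
ultrafilters. -/
lemma exists_tendsto_of_finiteDimensional {X ι : Type*} (V : Submodule ℂ (X → ℂ))
    [FiniteDimensional ℂ V] (S : Set X) (hS : ∀ f ∈ V, (∀ s ∈ S, f s = 0) → f = 0)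
    (U : Ultrafilter ι) (p : ι → X → ℂ) (hp : ∀ i, p i ∈ V)
    (hb : ∀ s ∈ S, ∃ C : ℝ, ∀ᶠ i in U, ‖p i s‖ ≤ C) :
    ∃ q ∈ V, ∀ x, Tendsto (fun i => p i x) U (𝓝 (q x)) := by
  let ev : X → Module.Dual ℂ V := fun x => (LinearMap.proj x).comp V.subtype
  -- Evaluations at `S` have no common kernel, so they span the dual. Every evaluation is then a
  -- finite combination of bounded ones, and its limit exists.
  have hspan : Submodule.span ℂ (ev '' S) = ⊤ := by
    have h1 : (Submodule.span ℂ (ev '' S)).dualCoannihilator = ⊥ := by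
      rw [eq_bot_iff]
      intro f hf
      rw [Submodule.mem_dualCoannihilator] at hf
      rw [Submodule.mem_bot]
      exact Subtype.ext (hS f f.2 fun s hs =>
        hf (ev s) (Submodule.subset_span (Set.mem_image_of_mem _ hs)))
    rw [← Subspace.dualCoannihilator_dualAnnihilator_eq (W := Submodule.span ℂ (ev '' S)), h1,
      Submodule.dualAnnihilator_bot]
  have hlim : ∀ φ : Module.Dual ℂ V, ∃ l, Tendsto (fun i => φ ⟨p i, hp i⟩) U (𝓝 l) := by
    intro φ
    have hφ : φ ∈ Submodule.span ℂ (ev '' S) := hspan ▸ Submodule.mem_top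
    induction hφ using Submodule.span_induction with
    | mem φ h =>
      obtain ⟨s, hs, rfl⟩ := h
      obtain ⟨C, hC⟩ := hb s hs
      obtain ⟨l, -, hl⟩ := (isCompact_closedBall (0 : ℂ) C).ultrafilter_le_nhds
        (U.map fun i => p i s) (by
          rw [le_principal_iff, Ultrafilter.coe_map, mem_map]
          filter_upwards [hC] with i hi
          simpa using hi)
      exact ⟨l, hl⟩
    | zero => exact ⟨0, by simp⟩
    | add φ χ _ _ h1 h2 =>
      obtain ⟨a, ha⟩ := h1
      obtain ⟨b, hb⟩ := h2
      exact ⟨a + b, ha.add hb⟩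
    | smul c φ _ h =>
      obtain ⟨a, ha⟩ := h
      exact ⟨c • a, ha.const_smul c⟩
  choose l hl using fun x => hlim (ev x)
  exact ⟨l, V.closed_of_finiteDimensional.mem_of_tendsto (tendsto_pi_nhds.2 hl)
    (Eventually.of_forall hp), hl⟩

lemma pureStellarRank_le_iff {m : ℕ} {ψ : FockSpace m} {n : ℕ} :
    pureStellarRank ψ ≤ n ↔
      ∃ P : MvPolynomial (Fin m) ℂ, HasStellarPolynomial ψ P ∧ P.totalDegree ≤ n := by
  constructor
  · intro h
    have h1 : pureStellarRank ψ < ((n + 1 : ℕ) : ℕ∞) :=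
      h.trans_lt (by exact_mod_cast Nat.lt_succ_self n)
    simp only [pureStellarRank, iInf_lt_iff] at h1
    obtain ⟨P, hP, hlt⟩ := h1
    exact ⟨P, hP, Nat.lt_succ_iff.1 (by exact_mod_cast hlt)⟩
  · rintro ⟨P, hP, hn⟩
    exact (iInf₂_le P hP).trans (by exact_mod_cast hn)

/-! ### Polynomial-times-Gaussian functions and their weak limits. -/

/-- The quadratic functions `z ↦ ½ zᵀ A z + bᵀ z + c`. -/
def quadraticFunction (m : ℕ) :
    (Matrix (Fin m) (Fin m) ℂ × (Fin m → ℂ) × ℂ) →ₗ[ℂ] ((Fin m → ℂ) → ℂ) where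
  toFun q z := (1 / 2) * (∑ i, ∑ j, z i * q.1 i j * z j) + ∑ j, q.2.1 j * z j + q.2.2
  map_add' p q := by
    funext z
    simp only [Prod.fst_add, Prod.snd_add, Matrix.add_apply, Pi.add_apply, mul_add, add_mul,
      Finset.sum_add_distrib]
    ring
  map_smul' c q := by
    funext z
    simp only [Prod.smul_fst, Prod.smul_snd, Matrix.smul_apply, Pi.smul_apply, smul_eq_mul,
      RingHom.id_apply, mul_add, Finset.mul_sum]
    congr 2
    · exact Finset.sum_congr rfl fun i _ => Finset.sum_congr rfl fun j _ => by ring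
    · exact Finset.sum_congr rfl fun i _ => by ring

lemma quadraticFunction_apply {m : ℕ} (A : Matrix (Fin m) (Fin m) ℂ) (b : Fin m → ℂ) (c : ℂ)
    (z : Fin m → ℂ) : quadraticFunction m (A, b, c) z =
      (1 / 2) * (∑ i, ∑ j, z i * A i j * z j) + ∑ j, b j * z j + c := rfl

lemma gaussianFunction_eq_exp {m : ℕ} (A : Matrix (Fin m) (Fin m) ℂ) (b : Fin m → ℂ)
    (z : Fin m → ℂ) : gaussianFunction A b z = Complex.exp (quadraticFunction m (A, b, 0) z) := by
  rw [quadraticFunction_apply, add_zero]; rfl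

lemma exists_mvPolynomial_quadraticFunction {m : ℕ}
    (q : Matrix (Fin m) (Fin m) ℂ × (Fin m → ℂ) × ℂ) :
    ∃ Q : MvPolynomial (Fin m) ℂ, Q.totalDegree ≤ 2 ∧
      ∀ z, quadraticFunction m q z = MvPolynomial.eval z Q := by
  obtain ⟨A, b, c⟩ := q
  refine ⟨MvPolynomial.C (1 / 2) *
      (∑ i, ∑ j, MvPolynomial.X i * MvPolynomial.C (A i j) * MvPolynomial.X j) +
      ∑ j, MvPolynomial.C (b j) * MvPolynomial.X j + MvPolynomial.C c, ?_, fun z => ?_⟩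
  · have hX : ∀ i : Fin m, (MvPolynomial.X i : MvPolynomial (Fin m) ℂ).totalDegree ≤ 1 :=
      fun i => (MvPolynomial.totalDegree_X i).le
    have hC : ∀ c : ℂ, (MvPolynomial.C c : MvPolynomial (Fin m) ℂ).totalDegree ≤ 0 :=
      fun c => (MvPolynomial.totalDegree_C c).le
    refine (MvPolynomial.totalDegree_add _ _).trans (max_le
      ((MvPolynomial.totalDegree_add _ _).trans (max_le ?_ ?_)) ((hC c).trans (by norm_num)))
    · refine (MvPolynomial.totalDegree_mul _ _).trans ?_
      refine (add_le_add (hC _) (MvPolynomial.totalDegree_finsetSum_le fun i _ =>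
        MvPolynomial.totalDegree_finsetSum_le (d := 2) fun j _ => ?_)).trans (zero_add 2).le
      refine (MvPolynomial.totalDegree_mul _ _).trans (add_le_add
        ((MvPolynomial.totalDegree_mul _ _).trans (add_le_add (hX i) (hC _))) (hX j))
    · refine MvPolynomial.totalDegree_finsetSum_le fun i _ => ?_
      exact (MvPolynomial.totalDegree_mul _ _).trans
        ((add_le_add (hC _) (hX i)).trans (by norm_num))
  · simp [quadraticFunction_apply]

lemma MvPolynomial.differentiable_eval {m : ℕ} (P : MvPolynomial (Fin m) ℂ) :
    Differentiable ℂ fun z => MvPolynomial.eval z P := by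
  induction P using MvPolynomial.induction_on with
  | C a => simp
  | add p q hp hq =>
    simp only [map_add]
    exact hp.fun_add hq
  | mul_X p i hp =>
    simp only [map_mul, MvPolynomial.eval_X]
    fun_prop

/-- The evaluations of the polynomials of total degree at most `n`. -/
def mvPolynomialFunctions (m n : ℕ) : Submodule ℂ ((Fin m → ℂ) → ℂ) :=
  (MvPolynomial.restrictTotalDegree (Fin m) ℂ n).map
    (LinearMap.pi fun z => (MvPolynomial.aeval (R := ℂ) z).toLinearMap)

lemma mem_mvPolynomialFunctions {m n : ℕ} {f : (Fin m → ℂ) → ℂ} :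
    f ∈ mvPolynomialFunctions m n ↔ ∃ P : MvPolynomial (Fin m) ℂ, P.totalDegree ≤ n ∧
      ∀ z, f z = MvPolynomial.eval z P := by
  simp only [mvPolynomialFunctions, Submodule.mem_map, MvPolynomial.mem_restrictTotalDegree]
  refine exists_congr fun P => and_congr_right fun _ => ?_
  rw [eq_comm, funext_iff]
  simp [MvPolynomial.aeval_eq_eval]

instance (m n : ℕ) : FiniteDimensional ℂ (mvPolynomialFunctions m n) := by
  unfold mvPolynomialFunctions; infer_instance

/-- On a complex line through `z₀` the polynomial factor has no zeros, so its values agree with `F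
z₀` up to `2 ^ n`. Dividing it out bounds `Re g` from above, and Borel–Carathéodory with `g z₀ = 0`
bounds `‖g‖`. -/
lemma norm_le_of_eq_mul_exp {m n : ℕ} {F f g : (Fin m → ℂ) → ℂ}
    (hf : f ∈ mvPolynomialFunctions m n) (hg : g ∈ LinearMap.range (quadraticFunction m))
    (hF : ∀ z, F z = f z * Complex.exp (g z)) {z₀ : Fin m → ℂ} (hg0 : g z₀ = 0) {r M δ : ℝ}
    (hr : 0 < r) (hδ : 0 < δ) (hδF : δ ≤ ‖F z₀‖) (hne : ∀ z ∈ ball z₀ r, F z ≠ 0)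
    (hM : ∀ z ∈ ball z₀ r, ‖F z‖ ≤ M) {w : Fin m → ℂ} (hw : w ∈ closedBall z₀ (r / 4)) :
    ‖f w‖ ≤ 2 ^ n * M ∧ ‖g w‖ ≤ 2 * (Real.log (2 ^ n * M / δ) + 1) := by
  obtain ⟨P, hPd, hP⟩ := mem_mvPolynomialFunctions.1 hf
  obtain ⟨q, rfl⟩ := hg
  obtain ⟨Q, hQd, hQ⟩ := exists_mvPolynomial_quadraticFunction q
  -- Scaled so that `‖v‖ ≤ 1`: the disc `‖t‖ < r` stays in the ball and `w` sits at `t = r / 4`.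
  set v : Fin m → ℂ := ((4 / r : ℝ) : ℂ) • (w - z₀) with hv
  set t₀ : ℂ := ((r / 4 : ℝ) : ℂ) with ht₀
  have ht₀n : ‖t₀‖ = r / 4 := by
    rw [ht₀, Complex.norm_real, Real.norm_eq_abs, abs_of_pos (by positivity)]
  have hvn : ‖v‖ ≤ 1 := by
    rw [hv, norm_smul, Complex.norm_real, Real.norm_eq_abs, abs_of_pos (by positivity)]
    rw [mem_closedBall, dist_eq_norm] at hw
    calc 4 / r * ‖w - z₀‖ ≤ 4 / r * (r / 4) := by gcongr
      _ = 1 := by field_simp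
  have hwv : z₀ + t₀ • v = w := by
    rw [hv, ht₀, smul_smul, ← Complex.ofReal_mul, show r / 4 * (4 / r) = 1 by field_simp]
    simp
  obtain ⟨p, hpd, hp⟩ := MvPolynomial.exists_polynomial_line hPd z₀ v
  obtain ⟨s, -, hs⟩ := MvPolynomial.exists_polynomial_line hQd z₀ v
  have hball : ∀ t : ℂ, ‖t‖ < r → z₀ + t • v ∈ ball z₀ r := fun t ht => by
    rw [mem_ball, dist_eq_norm, add_sub_cancel_left, norm_smul]
    exact (mul_le_of_le_one_right (norm_nonneg _) hvn).trans_lt ht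
  have hFt : ∀ t : ℂ, F (z₀ + t • v) = p.eval t * Complex.exp (s.eval t) := fun t => by
    rw [hF, hP, hQ, hp, hs]
  have hp0 : ∀ t : ℂ, ‖t‖ < r → p.eval t ≠ 0 := fun t ht h => by
    apply hne _ (hball t ht)
    rw [hFt, h, zero_mul]
  have hs0 : s.eval 0 = 0 := by rw [hs, ← hQ]; simpa using hg0
  have hF0 : F z₀ = p.eval 0 := by
    have := hFt 0
    rwa [zero_smul, add_zero, hs0, Complex.exp_zero, mul_one] at this
  have hMδ : δ ≤ M := hδF.trans (hM z₀ (mem_ball_self hr))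
  have hMpos : 0 < M := hδ.trans_le hMδ
  constructor
  · rw [← hwv, hP, ← hp]
    refine (Polynomial.norm_eval_le_of_forall_ne_zero hpd hp0 (by rw [ht₀n]; linarith)).trans ?_
    rw [← hF0]
    gcongr
    exact hM z₀ (mem_ball_self hr)
  · rw [← hwv, hQ, ← hs]
    have hlog : 0 ≤ Real.log (2 ^ n * M / δ) := by
      refine Real.log_nonneg ((one_le_div hδ).2 (hMδ.trans ?_))
      exact le_mul_of_one_le_left hMpos.le (one_le_pow₀ (by norm_num))
    -- The radius is `r / 2` because the lower bound on `p` needs `2 * ‖t‖ < r`; the `+ 1` makes the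
    -- bound strictly positive.
    refine (Complex.borelCaratheodory_zero (f := fun t => s.eval t) (R := r / 2)
      (M := Real.log (2 ^ n * M / δ) + 1) (by linarith) s.differentiable.differentiableOn
      (fun t ht => ?_) (by positivity) ?_ hs0).trans ?_
    · rw [mem_ball_zero_iff] at ht
      have h1 := Polynomial.norm_eval_zero_le_of_forall_ne_zero hpd hp0 (t := t) (by linarith)
      have h2 := hM _ (hball t (by linarith))
      rw [hFt, norm_mul, Complex.norm_exp] at h2
      have h3 : Real.exp (s.eval t).re ≤ 2 ^ n * M / δ := by
        rw [le_div_iff₀ hδ]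
        calc _ ≤ Real.exp (s.eval t).re * (2 ^ n * ‖p.eval t‖) := by
              gcongr; rw [hF0] at hδF; exact hδF.trans h1
          _ = 2 ^ n * (‖p.eval t‖ * Real.exp (s.eval t).re) := by ring
          _ ≤ _ := by gcongr
      have h4 := (Real.le_log_iff_exp_le (by positivity)).2 h3
      change (s.eval t).re ≤ _
      linarith
    · rw [mem_ball_zero_iff, ht₀n]; linarith
    · rw [ht₀n]
      apply le_of_eq
      field_simp
      ring

/-- Pure states of stellar rank at most `n` are closed under bounded weak limits. -/
theorem pureStellarRank_le_of_tendsto {m n : ℕ} {ι : Type*} (U : Ultrafilter ι)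
    {φ : ι → FockSpace m} {ψ : FockSpace m} (hb : ∀ i, ‖φ i‖ ≤ 1)
    (hr : ∀ i, pureStellarRank (φ i) ≤ n)
    (hlim : ∀ y, Tendsto (fun i => ⟪φ i, y⟫_ℂ) U (𝓝 ⟪ψ, y⟫_ℂ)) : pureStellarRank ψ ≤ n := by
  have hlimF : ∀ z, Tendsto (fun i => stellarFunction (φ i) z) U (𝓝 (stellarFunction ψ z)) := by
    intro z
    simp_rw [stellarFunction_eq_inner]
    have := (Complex.continuous_conj.tendsto _).comp (hlim (coherentState z))
    simpa [Function.comp_def, inner_conj_symm] using this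
  rw [pureStellarRank_le_iff]
  by_cases hzero : ∀ z, stellarFunction ψ z = 0
  · exact ⟨0, ⟨0, 0, by simp [Matrix.IsSymm], fun z => by simp [hzero z]⟩, by simp⟩
  push Not at hzero
  obtain ⟨z₀, hz₀⟩ := hzero
  have hex : ∀ i, ∃ f ∈ mvPolynomialFunctions m n, ∃ g ∈ LinearMap.range (quadraticFunction m),
      g z₀ = 0 ∧ ∀ z, stellarFunction (φ i) z = f z * Complex.exp (g z) := by
    intro i
    obtain ⟨P, ⟨A, b, -, h⟩, hd⟩ := pureStellarRank_le_iff.1 (hr i)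
    -- Moving the constant `exp c` into the polynomial makes the exponent vanish at `z₀`, so a
    -- constant can no longer be traded between the two factors.
    set c := quadraticFunction m (A, b, 0) z₀ with hc
    refine ⟨Complex.exp c • fun z => MvPolynomial.eval z P,
      Submodule.smul_mem _ _ (mem_mvPolynomialFunctions.2 ⟨P, hd, fun _ => rfl⟩),
      quadraticFunction m (A, b, -c), ⟨_, rfl⟩, ?_, fun z => ?_⟩
    · rw [quadraticFunction_apply, hc, quadraticFunction_apply]; ring
    · rw [h, gaussianFunction_eq_exp, Pi.smul_apply, smul_eq_mul, mul_comm (Complex.exp c),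
        mul_assoc, ← Complex.exp_add, quadraticFunction_apply, quadraticFunction_apply]
      congr 2; ring
  choose f hf g hg hg0 hfg using hex
  set δ := ‖stellarFunction ψ z₀‖ / 2 with hδ
  have hδpos : 0 < δ := by have := norm_pos_iff.2 hz₀; positivity
  have hδF : ∀ᶠ i in U, δ < ‖stellarFunction (φ i) z₀‖ :=
    (hlimF z₀).norm.eventually_const_lt (by
      have := norm_pos_iff.2 hz₀
      rw [hδ]; linarith)
  obtain ⟨M, hMpos, hM⟩ : ∃ M : ℝ, 0 < M ∧ ∀ i, ∀ z ∈ ball z₀ 1,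
      ‖stellarFunction (φ i) z‖ ≤ M := by
    refine ⟨Real.sqrt (Real.exp ((‖z₀‖ + 1) ^ 2) ^ m), by positivity, fun i z hz => ?_⟩
    refine norm_stellarFunction_le (hb i) ?_
    rw [mem_ball, dist_eq_norm] at hz
    have := norm_le_norm_add_norm_sub' z z₀
    linarith
  have hdiff : ∀ i, Differentiable ℂ (stellarFunction (φ i)) := by
    intro i
    rw [funext (hfg i)]
    obtain ⟨P, -, hP⟩ := mem_mvPolynomialFunctions.1 (hf i)
    obtain ⟨q, hq⟩ := hg i
    obtain ⟨Q, -, hQ⟩ := exists_mvPolynomial_quadraticFunction q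
    simp_rw [← hq, hP, hQ]
    exact P.differentiable_eval.mul Q.differentiable_eval.cexp
  -- By Schwarz, each approximant moves by at most `2 * M * dist z z₀` on the unit ball. Within `r`
  -- this is less than `δ`, so no zero occurs; the same `r` serves all `i` with `δ < ‖F_i z₀‖`.
  set r := min 1 (δ / (2 * M)) with hrdef
  have hrpos : 0 < r := by positivity
  have hne : ∀ i, δ < ‖stellarFunction (φ i) z₀‖ → ∀ z ∈ ball z₀ r,
      stellarFunction (φ i) z ≠ 0 := by
    intro i hi z hz h0
    have hz1 : z ∈ ball z₀ 1 := ball_subset_ball (min_le_left _ _) hz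
    have h := Complex.dist_le_div_mul_dist_of_mapsTo_ball (R₁ := 1) (R₂ := 2 * M) (z := z)
      (c := z₀) (hdiff i).differentiableOn (fun w hw => by
        rw [mem_closedBall, dist_eq_norm]
        have h1 := norm_sub_le (stellarFunction (φ i) w) (stellarFunction (φ i) z₀)
        have h2 := hM i w hw
        have h3 := hM i z₀ (mem_ball_self one_pos)
        linarith) hz1
    rw [h0, dist_zero_left, div_one] at h
    have h4 : dist z z₀ < δ / (2 * M) := hz.trans_le (min_le_right _ _)
    rw [lt_div_iff₀ (by positivity)] at h4
    linarith
  have hbd : ∀ᶠ i in U, ∀ w ∈ closedBall z₀ (r / 4), ‖f i w‖ ≤ 2 ^ n * M ∧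
      ‖g i w‖ ≤ 2 * (Real.log (2 ^ n * M / δ) + 1) := by
    filter_upwards [hδF] with i hi w hw
    exact norm_le_of_eq_mul_exp (hf i) (hg i) (hfg i) (hg0 i) hrpos hδpos hi.le (hne i hi)
      (fun z hz => hM i z (ball_subset_ball (min_le_left _ _) hz)) hw
  have hr4 : 0 < r / 4 := by positivity
  obtain ⟨p, hp, hplim⟩ := exists_tendsto_of_finiteDimensional (mvPolynomialFunctions m n)
    (closedBall z₀ (r / 4)) (fun h hh h0 => by
      obtain ⟨P, -, hP⟩ := mem_mvPolynomialFunctions.1 hh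
      have := MvPolynomial.eq_zero_of_forall_closedBall hr4 fun w hw => (hP w).symm.trans (h0 w hw)
      funext z
      simp [hP, this]) U f hf fun s hs => ⟨_, hbd.mono fun i hi => (hi s hs).1⟩
  obtain ⟨q, ⟨⟨A, b, c⟩, rfl⟩, hqlim⟩ := exists_tendsto_of_finiteDimensional
    (LinearMap.range (quadraticFunction m))
    (closedBall z₀ (r / 4)) (fun h hh h0 => by
      obtain ⟨q, rfl⟩ := hh
      obtain ⟨Q, -, hQ⟩ := exists_mvPolynomial_quadraticFunction q
      have := MvPolynomial.eq_zero_of_forall_closedBall hr4 fun w hw => (hQ w).symm.trans (h0 w hw)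
      funext z
      simp [hQ, this]) U g hg fun s hs => ⟨_, hbd.mono fun i hi => (hi s hs).2⟩
  obtain ⟨P, hPd, hP⟩ := mem_mvPolynomialFunctions.1 hp
  -- The matrix representing the limit exponent need not be symmetric; symmetrising leaves the
  -- quadratic form unchanged.
  refine ⟨MvPolynomial.C (Complex.exp c) * P, ⟨(1 / 2 : ℂ) • (A + A.transpose), b, ?_, fun z => ?_⟩,
    (MvPolynomial.totalDegree_mul _ _).trans (by simpa using hPd)⟩
  · rw [Matrix.IsSymm, Matrix.transpose_smul, Matrix.transpose_add, Matrix.transpose_transpose,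
      add_comm]
  · have h1 : stellarFunction ψ z = p z * Complex.exp (quadraticFunction m (A, b, c) z) := by
      refine tendsto_nhds_unique (hlimF z) ?_
      simp_rw [hfg]
      exact (hplim z).mul ((Complex.continuous_exp.tendsto _).comp (hqlim z))
    have h2 : ∑ i, ∑ j, z i * ((1 / 2 : ℂ) • (A + A.transpose)) i j * z j =
        ∑ i, ∑ j, z i * A i j * z j := by
      have h3 : ∑ i, ∑ j, z i * A j i * z j = ∑ i, ∑ j, z i * A i j * z j := by
        rw [Finset.sum_comm]
        exact Finset.sum_congr rfl fun i _ => Finset.sum_congr rfl fun j _ => by ring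
      calc _ = (1 / 2) * (∑ i, ∑ j, z i * A i j * z j) +
            (1 / 2) * ∑ i, ∑ j, z i * A j i * z j := by
            simp only [Finset.mul_sum, ← Finset.sum_add_distrib]
            refine Finset.sum_congr rfl fun i _ => Finset.sum_congr rfl fun j _ => ?_
            simp only [Matrix.smul_apply, Matrix.add_apply, Matrix.transpose_apply, smul_eq_mul]
            ring
        _ = _ := by rw [h3]; ring
    rw [h1, hP, gaussianFunction_eq_exp, quadraticFunction_apply, quadraticFunction_apply, h2,
      map_mul, MvPolynomial.eval_C, add_zero, Complex.exp_add _ c]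
    ring

/-! ### Hilbert–Schmidt estimates and basic properties of the fidelity. -/

lemma orthonormal_fockState (m : ℕ) : Orthonormal ℂ (fockState (m := m)) := by
  have := (fockBasis m).orthonormal
  rwa [funext fockBasis_apply] at this

lemma norm_fockState {m : ℕ} (n : Fin m → ℕ) : ‖fockState n‖ = 1 :=
  (orthonormal_fockState m).1 n

lemma hasSum_inner_smul_fockState {m : ℕ} (x : FockSpace m) :
    HasSum (fun n => ⟪fockState n, x⟫_ℂ • fockState n) x := by
  have := (fockBasis m).hasSum_repr x
  simpa only [HilbertBasis.repr_apply_apply, fockBasis_apply] using this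

lemma hasSum_norm_inner_fockState_sq {m : ℕ} (x : FockSpace m) :
    HasSum (fun n => ‖⟪fockState n, x⟫_ℂ‖ ^ 2) (‖x‖ ^ 2) := by
  have h := Complex.hasSum_re ((fockBasis m).hasSum_inner_mul_inner x x)
  simp only [fockBasis_apply, inner_self_eq_norm_sq_to_K] at h
  convert h using 1
  · funext n
    rw [← inner_conj_symm x, ← Complex.normSq_eq_conj_mul_self, Complex.ofReal_re,
      Complex.normSq_eq_norm_sq]
  · norm_cast

lemma isSelfAdjoint_inner {m : ℕ} {A : FockOp m} (hA : 0 ≤ A) (x y : FockSpace m) :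
    ⟪A x, y⟫_ℂ = ⟪x, A y⟫_ℂ :=
  ((ContinuousLinearMap.nonneg_iff_isPositive A).1 hA).isSymmetric x y

/-- Through this, trace one for `ρ` says that `√ρ` has Hilbert–Schmidt norm one. -/
lemma re_inner_sqrt_mul_sqrt {m : ℕ} {A : FockOp m} (hA : 0 ≤ A) (x : FockSpace m) :
    (⟪x, A x⟫_ℂ).re = ‖CFC.sqrt A x‖ ^ 2 := by
  conv_lhs => rw [← CFC.sqrt_mul_sqrt_self A hA]
  rw [mul_apply_eq_comp, ← isSelfAdjoint_inner (CFC.sqrt_nonneg A),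
    inner_self_eq_norm_sq_to_K]
  norm_cast

/-- The Hilbert–Schmidt norm does not increase under composition with a contraction. -/
lemma sum_norm_apply_contraction_sq_le {m : ℕ} {S Y : FockOp m} (hS : 0 ≤ S) {c : ℝ}
    (hc : HasSum (fun n => ‖S (fockState n)‖ ^ 2) c) (hY : ‖Y‖ ≤ 1) (s : Finset (Fin m → ℕ)) :
    ∑ n ∈ s, ‖S (Y (fockState n))‖ ^ 2 ≤ c := by
  refine hasSum_le (fun k => ?_)
    (hasSum_sum fun n (_ : n ∈ s) => hasSum_norm_inner_fockState_sq (S (Y (fockState n)))) hc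
  -- Expand in the Fock basis, exchange rows and columns by taking adjoints, and apply Bessel row by
  -- row.
  calc ∑ n ∈ s, ‖⟪fockState k, S (Y (fockState n))⟫_ℂ‖ ^ 2
      = ∑ n ∈ s, ‖⟪fockState n, ContinuousLinearMap.adjoint Y (S (fockState k))⟫_ℂ‖ ^ 2 := by
        refine Finset.sum_congr rfl fun n _ => ?_
        rw [ContinuousLinearMap.adjoint_inner_right, ← isSelfAdjoint_inner hS, norm_inner_symm]
    _ ≤ ‖ContinuousLinearMap.adjoint Y (S (fockState k))‖ ^ 2 :=
        (orthonormal_fockState m).sum_inner_products_le _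
    _ ≤ ‖S (fockState k)‖ ^ 2 := by
        gcongr
        refine (ContinuousLinearMap.le_opNorm _ _).trans
          (mul_le_of_le_one_left (norm_nonneg _) ?_)
        rwa [LinearIsometryEquiv.norm_map]

section Density

variable {m : ℕ} {ρ σ : FockOp m}

lemma IsDensityOperator.nonneg (hρ : IsDensityOperator ρ) : 0 ≤ ρ :=
  (ContinuousLinearMap.nonneg_iff_isPositive ρ).2 hρ.1

lemma IsDensityOperator.hasSum_norm_sqrt_sq (hρ : IsDensityOperator ρ) :
    HasSum (fun n => ‖CFC.sqrt ρ (fockState n)‖ ^ 2) 1 := by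
  have h := Complex.hasSum_re hρ.2
  simpa only [re_inner_sqrt_mul_sqrt hρ.nonneg, Complex.one_re] using h

/-- For a positive `A` with `A² = (S B)† (S B)`, partial traces of `A` are bounded by the
Hilbert–Schmidt norms of `S` and `B`. -/
lemma sum_inner_le_of_mul_self_eq {A B S : FockOp m} (hA : 0 ≤ A) (hB : 0 ≤ B) (hS : 0 ≤ S)
    (hABS : A * A = B * (S * S) * B) (hS1 : HasSum (fun n => ‖S (fockState n)‖ ^ 2) 1)
    (s : Finset (Fin m → ℕ)) :
    ∑ n ∈ s, (⟪fockState n, A (fockState n)⟫_ℂ).re ≤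
      √(∑ n ∈ s, ‖B (fockState n)‖ ^ 2) := by
  have hAsa : IsSelfAdjoint A := .of_nonneg hA
  have key : ∀ δ : ℝ, 0 < δ → ∑ n ∈ s, (⟪fockState n, A (fockState n)⟫_ℂ).re ≤
      √(∑ n ∈ s, ‖B (fockState n)‖ ^ 2) + s.card * δ := by
    intro δ hδ
    have hsp : ∀ x ∈ spectrum ℝ A, 0 ≤ x := fun x hx => spectrum_nonneg_of_nonneg hA hx
    have hcont : ContinuousOn (fun x : ℝ => 1 / (x + δ)) (spectrum ℝ A) := by
      refine ContinuousOn.div (by fun_prop) (by fun_prop) fun x hx => ?_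
      have := hsp x hx
      positivity
    -- `R` is the regularised inverse `(A + δ)⁻¹`, for which `A R A` is within `δ` of `A`.
    set R : FockOp m := cfc (fun x : ℝ => 1 / (x + δ)) A with hR
    have hR0 : 0 ≤ R := cfc_nonneg fun x hx => by
      have := hsp x hx
      positivity
    have hAR : A * R = cfc (fun x : ℝ => x * (1 / (x + δ))) A := by
      rw [cfc_mul (fun x : ℝ => x) _ A (by fun_prop) hcont, cfc_id' ℝ A]
    have hRA : A * R = R * A := by
      have h : R * A = cfc (fun x : ℝ => 1 / (x + δ) * x) A := by
        rw [cfc_mul _ (fun x : ℝ => x) A hcont (by fun_prop), cfc_id' ℝ A]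
      rw [hAR, h]
      simp_rw [mul_comm]
    have hARn : ‖A * R‖ ≤ 1 := by
      rw [hAR]
      refine norm_cfc_le zero_le_one fun x hx => ?_
      have h0 := hsp x hx
      rw [Real.norm_eq_abs, abs_of_nonneg (by positivity), mul_one_div,
        div_le_one (by positivity)]
      linarith
    have hdiff : ‖A - A * R * A‖ ≤ δ := by
      have h : A - A * R * A = cfc (fun x : ℝ => x - x * (1 / (x + δ)) * x) A := by
        rw [cfc_sub (fun x : ℝ => x) (fun x : ℝ => x * (1 / (x + δ)) * x) A (by fun_prop)
            ((continuousOn_id.mul hcont).mul continuousOn_id),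
          cfc_mul (fun x : ℝ => x * (1 / (x + δ))) (fun x : ℝ => x) A
            (continuousOn_id.mul hcont) (by fun_prop), cfc_id' ℝ A, hAR]
      rw [h]
      refine norm_cfc_le hδ.le fun x hx => ?_
      have h0 := hsp x hx
      have h1 : x - x * (1 / (x + δ)) * x = x * δ / (x + δ) := by
        field_simp
        ring
      rw [h1, Real.norm_eq_abs, abs_of_nonneg (by positivity), div_le_iff₀ (by positivity)]
      nlinarith
    -- `Y` stands in for the partial isometry in the polar decomposition of `S B`: `Y† Y = (A R)²`,
    -- so it is a contraction, and `A R A = Y† S B`.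
    set Y : FockOp m := S * B * R with hY
    have hYn : ‖Y‖ ≤ 1 := by
      refine ContinuousLinearMap.opNorm_le_bound _ zero_le_one fun v => ?_
      have h : ‖Y v‖ ^ 2 = ‖(A * R) v‖ ^ 2 := by
        have h1 : (⟪Y v, Y v⟫_ℂ) = ⟪(A * R) v, (A * R) v⟫_ℂ := by
          calc ⟪Y v, Y v⟫_ℂ = ⟪R v, (B * (S * S) * B) (R v)⟫_ℂ := by
                simp only [hY, mul_apply_eq_comp, isSelfAdjoint_inner hS,
                  isSelfAdjoint_inner hB]
            _ = _ := by
                rw [← hABS]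
                simp only [mul_apply_eq_comp, isSelfAdjoint_inner hA]
        rw [inner_self_eq_norm_sq_to_K, inner_self_eq_norm_sq_to_K] at h1
        exact_mod_cast h1
      rw [pow_left_inj₀ (norm_nonneg _) (norm_nonneg _) two_ne_zero] at h
      rw [h]
      exact (ContinuousLinearMap.le_opNorm _ _).trans (by gcongr)
    have hterm : ∀ n, (⟪fockState n, A (fockState n)⟫_ℂ).re ≤
        ‖S (Y (fockState n))‖ * ‖B (fockState n)‖ + δ := by
      intro n
      set e := fockState n
      have he : ‖e‖ = 1 := norm_fockState n
      have h1 : ⟪e, A e⟫_ℂ = ⟪S (Y e), B e⟫_ℂ + ⟪e, (A - A * R * A) e⟫_ℂ := by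
        have h2 : ⟪S (Y e), B e⟫_ℂ = ⟪e, (A * R * A) e⟫_ℂ := by
          rw [hRA, mul_assoc, hABS]
          simp only [hY, mul_apply_eq_comp, isSelfAdjoint_inner hS,
            isSelfAdjoint_inner hB, isSelfAdjoint_inner hR0]
        rw [h2, ← inner_add_right, sub_apply, add_sub_cancel]
      rw [h1, Complex.add_re]
      refine add_le_add ?_ ?_
      · exact (Complex.re_le_norm _).trans (norm_inner_le_norm _ _)
      · refine (Complex.re_le_norm _).trans ((norm_inner_le_norm _ _).trans ?_)
        rw [he, one_mul]
        refine (ContinuousLinearMap.le_opNorm _ _).trans ?_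
        rwa [he, mul_one]
    calc _ ≤ ∑ n ∈ s, (‖S (Y (fockState n))‖ * ‖B (fockState n)‖ + δ) :=
          Finset.sum_le_sum fun n _ => hterm n
      _ = ∑ n ∈ s, ‖S (Y (fockState n))‖ * ‖B (fockState n)‖ + s.card * δ := by
          rw [Finset.sum_add_distrib, Finset.sum_const, nsmul_eq_mul]
      _ ≤ _ := by
          gcongr
          refine (Real.sum_mul_le_sqrt_mul_sqrt s _ _).trans
            (mul_le_of_le_one_left (Real.sqrt_nonneg _) ?_)
          refine Real.sqrt_le_one.2 ?_
          exact sum_norm_apply_contraction_sq_le hS hS1 hYn s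
  have hlim : Tendsto (fun δ : ℝ => √(∑ n ∈ s, ‖B (fockState n)‖ ^ 2) + s.card * δ) (𝓝[>] 0)
      (𝓝 (√(∑ n ∈ s, ‖B (fockState n)‖ ^ 2) + s.card * 0)) :=
    (Continuous.tendsto (by fun_prop) _).mono_left nhdsWithin_le_nhds
  rw [mul_zero, add_zero] at hlim
  exact ge_of_tendsto hlim (eventually_nhdsWithin_of_forall key)

/-- The operator `√ρ σ √ρ`, whose square root has the root fidelity as trace, is positive. -/
lemma conjugate_sqrt_nonneg (ρ : FockOp m) {σ : FockOp m} (hσ : 0 ≤ σ) :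
    0 ≤ CFC.sqrt ρ * σ * CFC.sqrt ρ :=
  IsSelfAdjoint.conjugate_nonneg hσ (.of_nonneg (CFC.sqrt_nonneg (A := FockOp m) ρ))

/-- The bound does not involve `σ`, so the trace tails are small uniformly over all states; this
drives the semicontinuity. -/
lemma sum_inner_sqrt_conjugate_le (hσ : IsDensityOperator σ) (s : Finset (Fin m → ℕ)) :
    ∑ n ∈ s, (⟪fockState n, CFC.sqrt (CFC.sqrt ρ * σ * CFC.sqrt ρ) (fockState n)⟫_ℂ).re ≤
      √(∑ n ∈ s, ‖CFC.sqrt ρ (fockState n)‖ ^ 2) := by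
  refine sum_inner_le_of_mul_self_eq (m := m) (CFC.sqrt_nonneg (A := FockOp m) _)
    (CFC.sqrt_nonneg (A := FockOp m) ρ) (CFC.sqrt_nonneg (A := FockOp m) σ) ?_
    hσ.hasSum_norm_sqrt_sq s
  rw [CFC.sqrt_mul_sqrt_self _ (conjugate_sqrt_nonneg ρ hσ.nonneg),
    CFC.sqrt_mul_sqrt_self _ hσ.nonneg]

lemma re_inner_nonneg {A : FockOp m} (hA : 0 ≤ A) (x : FockSpace m) : 0 ≤ (⟪x, A x⟫_ℂ).re := by
  rw [re_inner_sqrt_mul_sqrt hA]; positivity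

lemma sum_norm_sqrt_sq_le_one (hρ : IsDensityOperator ρ) (s : Finset (Fin m → ℕ)) :
    ∑ n ∈ s, ‖CFC.sqrt ρ (fockState n)‖ ^ 2 ≤ 1 :=
  sum_le_hasSum s (fun n _ => by positivity) hρ.hasSum_norm_sqrt_sq

lemma sum_inner_sqrt_conjugate_le_one (hρ : IsDensityOperator ρ) (hσ : IsDensityOperator σ)
    (s : Finset (Fin m → ℕ)) :
    ∑ n ∈ s, (⟪fockState n, CFC.sqrt (CFC.sqrt ρ * σ * CFC.sqrt ρ) (fockState n)⟫_ℂ).re ≤ 1 :=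
  (sum_inner_sqrt_conjugate_le hσ s).trans
    (Real.sqrt_le_one.2 (sum_norm_sqrt_sq_le_one hρ s))

lemma summable_inner_sqrt_conjugate (hρ : IsDensityOperator ρ) (hσ : IsDensityOperator σ) :
    Summable fun n =>
      (⟪fockState n, CFC.sqrt (CFC.sqrt ρ * σ * CFC.sqrt ρ) (fockState n)⟫_ℂ).re :=
  summable_of_sum_le (fun _ => re_inner_nonneg (CFC.sqrt_nonneg (A := FockOp m) _) _)
    (sum_inner_sqrt_conjugate_le_one hρ hσ)

lemma posTrace_nonneg {A : FockOp m} (hA : 0 ≤ A) : 0 ≤ posTrace A :=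
  tsum_nonneg fun _ => re_inner_nonneg hA _

theorem fidelity_nonneg (ρ σ : FockOp m) : 0 ≤ fidelity ρ σ := sq_nonneg _

theorem fidelity_le_one (hρ : IsDensityOperator ρ) (hσ : IsDensityOperator σ) :
    fidelity ρ σ ≤ 1 :=
  pow_le_one₀ (posTrace_nonneg (CFC.sqrt_nonneg _))
    ((summable_inner_sqrt_conjugate hρ hσ).tsum_le_of_sum_le
      (sum_inner_sqrt_conjugate_le_one hρ hσ))

theorem fidelity_self (hρ : IsDensityOperator ρ) : fidelity ρ ρ = 1 := by
  have h : CFC.sqrt (CFC.sqrt ρ * ρ * CFC.sqrt ρ) = ρ := by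
    refine CFC.sqrt_unique ?_ hρ.nonneg
    have h2 := CFC.sqrt_mul_sqrt_self ρ hρ.nonneg
    set B := CFC.sqrt ρ
    rw [← h2]
    simp only [mul_assoc]
  have h3 := (Complex.hasSum_re hρ.2).tsum_eq
  rw [fidelity, h, posTrace, h3, Complex.one_re, one_pow]

lemma sqrt_conjugate_smul (ρ : FockOp m) {σ : FockOp m} (hσ : 0 ≤ σ) {t : ℝ} (ht : 0 ≤ t) :
    CFC.sqrt (CFC.sqrt ρ * ((t : ℂ) • σ) * CFC.sqrt ρ) =
      ((√t : ℝ) : ℂ) • CFC.sqrt (CFC.sqrt ρ * σ * CFC.sqrt ρ) := by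
  have hC := CFC.sqrt_mul_sqrt_self _ (conjugate_sqrt_nonneg ρ hσ)
  have hC0 : 0 ≤ CFC.sqrt (CFC.sqrt ρ * σ * CFC.sqrt ρ) := CFC.sqrt_nonneg (A := FockOp m) _
  generalize CFC.sqrt (CFC.sqrt ρ * σ * CFC.sqrt ρ) = C at hC hC0
  generalize CFC.sqrt ρ = B at hC
  refine CFC.sqrt_unique ?_ ?_
  · have h1 : (((√t : ℝ) : ℂ) • C) * (((√t : ℝ) : ℂ) • C) = (t : ℂ) • (C * C) := by
      ext1 x
      simp only [mul_apply_eq_comp, smul_apply, map_smul, smul_smul]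
      rw [← Complex.ofReal_mul, Real.mul_self_sqrt ht]
    rw [h1, hC]
    ext1 x
    simp only [mul_apply_eq_comp, smul_apply, map_smul]
  · rw [ContinuousLinearMap.nonneg_iff_isPositive] at hC0 ⊢
    refine hC0.smul_of_nonneg ?_
    exact_mod_cast Real.sqrt_nonneg t

/-- The square root contributes `√t` and the outer square restores `t`; used to renormalise a limit
that lost mass. -/
theorem fidelity_smul (ρ : FockOp m) {σ : FockOp m} (hσ : 0 ≤ σ) {t : ℝ} (ht : 0 ≤ t) :
    fidelity ρ ((t : ℂ) • σ) = t * fidelity ρ σ := by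
  rw [fidelity, fidelity, sqrt_conjugate_smul ρ hσ ht]
  generalize CFC.sqrt (CFC.sqrt ρ * σ * CFC.sqrt ρ) = C
  have h : posTrace (((√t : ℝ) : ℂ) • C) = √t * posTrace C := by
    rw [posTrace, posTrace, ← tsum_mul_left]
    refine tsum_congr fun n => ?_
    rw [smul_apply, inner_smul_right, Complex.re_ofReal_mul]
  rw [h, mul_pow, Real.sq_sqrt ht]

end Density

/-! ### Weak upper semicontinuity of the fidelity. -/

section Semicontinuity

variable {m : ℕ} {ρ σ : FockOp m}

/-- The orthogonal projection onto the span of finitely many Fock states. -/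
def fockProj (s : Finset (Fin m → ℕ)) : FockOp m :=
  ∑ n ∈ s, InnerProductSpace.rankOne ℂ (fockState n) (fockState n)

lemma fockProj_apply (s : Finset (Fin m → ℕ)) (x : FockSpace m) :
    fockProj s x = ∑ n ∈ s, ⟪fockState n, x⟫_ℂ • fockState n := by
  simp [fockProj]

lemma adjoint_fockProj (s : Finset (Fin m → ℕ)) :
    ContinuousLinearMap.adjoint (fockProj s) = fockProj s := by
  simp [fockProj]

lemma fockProj_mul_mul_fockProj (s : Finset (Fin m → ℕ)) (Z : FockOp m) :
    fockProj s * Z * fockProj s = ∑ n ∈ s, ∑ k ∈ s,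
      ⟪fockState n, Z (fockState k)⟫_ℂ •
        InnerProductSpace.rankOne ℂ (fockState n) (fockState k) := by
  ext1 x
  simp only [mul_apply_eq_comp, fockProj_apply, map_sum, map_smul, sum_apply, smul_apply,
    InnerProductSpace.rankOne_apply, Finset.smul_sum, smul_smul]
  rw [Finset.sum_comm]
  refine Finset.sum_congr rfl fun n _ => Finset.sum_congr rfl fun k _ => ?_
  rw [mul_comm]

/-- Truncating a Hilbert–Schmidt operator: the operator norm of the remainder is controlled by the
Hilbert–Schmidt norm of the tail. -/
lemma norm_sub_mul_fockProj_le (B : FockOp m) (s : Finset (Fin m → ℕ)) {c : ℝ} (hc : 0 ≤ c)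
    (h : ∀ t, Disjoint t s → ∑ n ∈ t, ‖B (fockState n)‖ ^ 2 ≤ c ^ 2) :
    ‖B - B * fockProj s‖ ≤ c := by
  classical
  refine ContinuousLinearMap.opNorm_le_bound _ hc fun x => ?_
  have hlim : Tendsto (fun t => ‖B (fockProj t x) - B (fockProj s x)‖) atTop
      (𝓝 ‖(B - B * fockProj s) x‖) := by
    rw [sub_apply, mul_apply_eq_comp]
    have h1 : Tendsto (fun t : Finset (Fin m → ℕ) => fockProj t x) atTop (𝓝 x) := by
      simp_rw [fockProj_apply]
      exact hasSum_inner_smul_fockState x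
    exact (((B.continuous.tendsto x).comp h1).sub_const _).norm
  refine le_of_tendsto hlim ?_
  filter_upwards [eventually_ge_atTop s] with t hst
  have h2 : B (fockProj t x) - B (fockProj s x) =
      ∑ n ∈ t \ s, ⟪fockState n, x⟫_ℂ • B (fockState n) := by
    rw [← map_sub, fockProj_apply, fockProj_apply, ← Finset.sum_sdiff hst, add_sub_cancel_right,
      map_sum]
    simp_rw [map_smul]
  rw [h2]
  calc _ ≤ ∑ n ∈ t \ s, ‖B (fockState n)‖ * ‖⟪fockState n, x⟫_ℂ‖ := by
        refine (norm_sum_le _ _).trans (Finset.sum_le_sum fun n _ => ?_)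
        rw [norm_smul, mul_comm]
    _ ≤ √(∑ n ∈ t \ s, ‖B (fockState n)‖ ^ 2) * √(∑ n ∈ t \ s, ‖⟪fockState n, x⟫_ℂ‖ ^ 2) :=
        Real.sum_mul_le_sqrt_mul_sqrt _ _ _
    _ ≤ c * ‖x‖ := by
        gcongr
        · exact Real.sqrt_le_iff.2 ⟨hc, h _ Finset.sdiff_disjoint⟩
        · exact Real.sqrt_le_iff.2 ⟨norm_nonneg _,
            (orthonormal_fockState m).sum_inner_products_le x⟩

lemma IsDensityOperator.norm_sqrt_le_one (hρ : IsDensityOperator ρ) : ‖CFC.sqrt ρ‖ ≤ 1 := by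
  -- With `s = ∅` the projection is zero, leaving operator norm at most Hilbert–Schmidt norm.
  have h := norm_sub_mul_fockProj_le (CFC.sqrt ρ) ∅ zero_le_one
    fun t _ => by simpa using sum_norm_sqrt_sq_le_one hρ t
  simpa [fockProj] using h

lemma IsDensityOperator.norm_le_one (hρ : IsDensityOperator ρ) : ‖ρ‖ ≤ 1 := by
  rw [← CFC.sqrt_mul_sqrt_self ρ hρ.nonneg]
  exact (norm_mul_le _ _).trans (mul_le_one₀ hρ.norm_sqrt_le_one (norm_nonneg _)
    hρ.norm_sqrt_le_one)

lemma IsDensityOperator.exists_finset_tail_le (hρ : IsDensityOperator ρ) {c : ℝ} (hc : 0 < c) :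
    ∃ s : Finset (Fin m → ℕ), ∀ t, Disjoint t s →
      ∑ n ∈ t, ‖CFC.sqrt ρ (fockState n)‖ ^ 2 ≤ c ^ 2 := by
  classical
  obtain ⟨s, hs⟩ := summable_iff_vanishing_norm.1 hρ.hasSum_norm_sqrt_sq.summable (c ^ 2)
    (by positivity)
  exact ⟨s, fun t ht => (Real.le_norm_self _).trans (hs t ht).le⟩

/-- Conjugation with the compact operator `√ρ` turns bounded weak convergence into norm
convergence. -/
lemma tendsto_conjugate_sqrt (hρ : IsDensityOperator ρ) {ι : Type*} {l : Filter ι}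
    {τ : ι → FockOp m} {T : FockOp m} (hτ : ∀ i, ‖τ i‖ ≤ 1) (hT : ‖T‖ ≤ 1)
    (hlim : ∀ n k, Tendsto (fun i => ⟪fockState n, τ i (fockState k)⟫_ℂ) l
      (𝓝 ⟪fockState n, T (fockState k)⟫_ℂ)) :
    Tendsto (fun i => CFC.sqrt ρ * τ i * CFC.sqrt ρ) l (𝓝 (CFC.sqrt ρ * T * CFC.sqrt ρ)) := by
  have hB1 := hρ.norm_sqrt_le_one
  have hBa : ContinuousLinearMap.adjoint (CFC.sqrt ρ) = CFC.sqrt ρ :=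
    ContinuousLinearMap.isSelfAdjoint_iff'.1 (.of_nonneg (CFC.sqrt_nonneg (A := FockOp m) ρ))
  have htail : ∀ c : ℝ, 0 < c → ∃ s, ‖CFC.sqrt ρ - CFC.sqrt ρ * fockProj s‖ ≤ c := fun c hc => by
    obtain ⟨s, hs⟩ := hρ.exists_finset_tail_le hc
    exact ⟨s, norm_sub_mul_fockProj_le _ s hc.le hs⟩
  generalize CFC.sqrt ρ = B at hB1 hBa htail ⊢
  have hdiff : ∀ (s : Finset (Fin m → ℕ)) (c : ℝ), c ≤ 1 → ‖B - B * fockProj s‖ ≤ c →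
      ∀ Z : FockOp m, ‖Z‖ ≤ 1 →
      ‖B * Z * B - B * (fockProj s * Z * fockProj s) * B‖ ≤ 3 * c := by
    intro s c hc1 hs Z hZ
    have hs' : ‖B - fockProj s * B‖ ≤ c := by
      have h : ContinuousLinearMap.adjoint (B - B * fockProj s) = B - fockProj s * B := by
        rw [map_sub, ContinuousLinearMap.mul_def, ContinuousLinearMap.adjoint_comp, hBa,
          adjoint_fockProj]
        rfl
      rwa [← h, LinearIsometryEquiv.norm_map]
    have hBP : ‖B * fockProj s‖ ≤ 2 := by
      have := norm_le_norm_add_norm_sub' (B * fockProj s) B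
      rw [norm_sub_rev] at this
      linarith
    have hc0 : 0 ≤ c := (norm_nonneg _).trans hs
    have h : B * Z * B - B * (fockProj s * Z * fockProj s) * B =
        (B - B * fockProj s) * Z * B + (B * fockProj s) * Z * (B - fockProj s * B) := by
      noncomm_ring
    rw [h]
    calc _ ≤ ‖B - B * fockProj s‖ * ‖Z‖ * ‖B‖ + ‖B * fockProj s‖ * ‖Z‖ * ‖B - fockProj s * B‖ :=
          (norm_add_le _ _).trans (add_le_add
            ((norm_mul_le _ _).trans (mul_le_mul_of_nonneg_right (norm_mul_le _ _) (norm_nonneg _)))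
            ((norm_mul_le _ _).trans
              (mul_le_mul_of_nonneg_right (norm_mul_le _ _) (norm_nonneg _))))
      _ ≤ c * 1 * 1 + 2 * 1 * c := by gcongr
      _ = 3 * c := by ring
  rw [Metric.tendsto_nhds]
  intro ε hε
  -- Two truncation errors of `3 * c` and a finite-rank error below `ε / 8` total less than `ε`; `c
  -- ≤ 1` keeps `‖B * fockProj s‖ ≤ 2`.
  set c := min 1 (ε / 8) with hc
  have hc0 : 0 < c := by positivity
  have hc8 : c ≤ ε / 8 := min_le_right _ _
  obtain ⟨s, hs⟩ := htail c hc0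
  have hfin : Tendsto (fun i => B * (fockProj s * τ i * fockProj s) * B) l
      (𝓝 (B * (fockProj s * T * fockProj s) * B)) := by
    refine Tendsto.mul_const _ (Tendsto.const_mul _ ?_)
    simp_rw [fockProj_mul_mul_fockProj]
    exact tendsto_finsetSum _ fun n _ => tendsto_finsetSum _ fun k _ =>
      (hlim n k).smul_const _
  filter_upwards [Metric.tendsto_nhds.1 hfin (ε / 8) (by positivity)] with i hi
  have h1 := hdiff s c (min_le_left _ _) hs (τ i) (hτ i)
  have h2 := hdiff s c (min_le_left _ _) hs T hT
  rw [dist_eq_norm] at hi ⊢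
  rw [norm_sub_rev] at h2
  have h3 := norm_add₃_le (a := B * τ i * B - B * (fockProj s * τ i * fockProj s) * B)
    (b := B * (fockProj s * τ i * fockProj s) * B - B * (fockProj s * T * fockProj s) * B)
    (c := B * (fockProj s * T * fockProj s) * B - B * T * B)
  rw [sub_add_sub_cancel, sub_add_sub_cancel] at h3
  linarith

/-- The fidelity with a fixed state is weakly upper semicontinuous; the limit may be
subnormalised. -/
theorem le_mul_fidelity_of_tendsto (hρ : IsDensityOperator ρ) (hσ : IsDensityOperator σ)
    {ι : Type*} {l : Filter ι} [l.NeBot] {τ : ι → FockOp m} (hτ : ∀ i, IsDensityOperator (τ i))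
    {t : ℝ} (ht0 : 0 ≤ t) (ht1 : t ≤ 1)
    (hlim : ∀ n k, Tendsto (fun i => ⟪fockState n, τ i (fockState k)⟫_ℂ) l
      (𝓝 ⟪fockState n, ((t : ℂ) • σ) (fockState k)⟫_ℂ))
    {f : ℝ} (hf : Tendsto (fun i => fidelity ρ (τ i)) l (𝓝 f)) :
    f ≤ t * fidelity ρ σ := by
  have hTn : ‖(t : ℂ) • σ‖ ≤ 1 := by
    rw [norm_smul, Complex.norm_real, Real.norm_eq_abs, abs_of_nonneg ht0]
    exact mul_le_one₀ ht1 (norm_nonneg _) hσ.norm_le_one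
  have hT0 : 0 ≤ (t : ℂ) • σ := by
    rw [ContinuousLinearMap.nonneg_iff_isPositive]
    exact hσ.1.smul_of_nonneg (by exact_mod_cast ht0)
  have h1 := tendsto_conjugate_sqrt hρ (fun i => (hτ i).norm_le_one) hTn hlim
  have h2 : Tendsto (fun i => CFC.sqrt (CFC.sqrt ρ * τ i * CFC.sqrt ρ)) l
      (𝓝 (CFC.sqrt (CFC.sqrt ρ * ((t : ℂ) • σ) * CFC.sqrt ρ))) := by
    have hc : ContinuousOn CFC.sqrt {a : FockOp m | 0 ≤ a} := CFC.continuousOn_sqrt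
    exact (hc _ (conjugate_sqrt_nonneg ρ hT0)).tendsto.comp (tendsto_nhdsWithin_iff.2
      ⟨h1, Eventually.of_forall fun i => conjugate_sqrt_nonneg ρ (hτ i).nonneg⟩)
  have hsum : Summable fun n => (⟪fockState n,
      CFC.sqrt (CFC.sqrt ρ * ((t : ℂ) • σ) * CFC.sqrt ρ) (fockState n)⟫_ℂ).re := by
    rw [sqrt_conjugate_smul ρ hσ.nonneg ht0]
    simp only [smul_apply, inner_smul_right, Complex.re_ofReal_mul]
    exact (summable_inner_sqrt_conjugate hρ hσ).mul_left _
  rw [← fidelity_smul ρ hσ.nonneg ht0]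
  have hroot : Tendsto (fun i => posTrace (CFC.sqrt (CFC.sqrt ρ * τ i * CFC.sqrt ρ))) l
      (𝓝 (√f)) := by
    refine (hf.sqrt).congr fun i => ?_
    exact Real.sqrt_sq (posTrace_nonneg (CFC.sqrt_nonneg (A := FockOp m) _))
  have hf0 : 0 ≤ f := ge_of_tendsto' hf fun i => fidelity_nonneg _ _
  suffices h : √f ≤ posTrace (CFC.sqrt (CFC.sqrt ρ * ((t : ℂ) • σ) * CFC.sqrt ρ)) by
    rw [fidelity, ← Real.sq_sqrt hf0]
    gcongr
  refine le_of_forall_pos_le_add fun c hc => ?_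
  -- The trace is not norm continuous, but one finite `s`, chosen from `ρ` alone, captures every
  -- root fidelity up to `c`.
  obtain ⟨s, hs⟩ := hρ.exists_finset_tail_le hc
  have hA0 : 0 ≤ CFC.sqrt (CFC.sqrt ρ * ((t : ℂ) • σ) * CFC.sqrt ρ) :=
    CFC.sqrt_nonneg (A := FockOp m) _
  have hle : ∀ i, posTrace (CFC.sqrt (CFC.sqrt ρ * τ i * CFC.sqrt ρ)) ≤
      ∑ n ∈ s, (⟪fockState n, CFC.sqrt (CFC.sqrt ρ * τ i * CFC.sqrt ρ) (fockState n)⟫_ℂ).re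
        + c := by
    classical
    intro i
    have hi0 : 0 ≤ CFC.sqrt (CFC.sqrt ρ * τ i * CFC.sqrt ρ) := CFC.sqrt_nonneg (A := FockOp m) _
    refine (summable_inner_sqrt_conjugate hρ (hτ i)).tsum_le_of_sum_le fun u => ?_
    rw [← Finset.sum_inter_add_sum_sdiff u s]
    refine add_le_add (Finset.sum_le_sum_of_subset_of_nonneg Finset.inter_subset_right
      fun n _ _ => re_inner_nonneg hi0 _) ?_
    refine (sum_inner_sqrt_conjugate_le (hτ i) _).trans ?_
    exact Real.sqrt_le_iff.2 ⟨hc.le, hs _ Finset.sdiff_disjoint⟩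
  have hfin : Tendsto (fun i => ∑ n ∈ s, (⟪fockState n,
      CFC.sqrt (CFC.sqrt ρ * τ i * CFC.sqrt ρ) (fockState n)⟫_ℂ).re + c) l
      (𝓝 (∑ n ∈ s, (⟪fockState n,
        CFC.sqrt (CFC.sqrt ρ * ((t : ℂ) • σ) * CFC.sqrt ρ) (fockState n)⟫_ℂ).re + c)) := by
    refine Tendsto.add_const _ (tendsto_finsetSum _ fun n _ => ?_)
    have h3 : Continuous fun A : FockOp m => (⟪fockState n, A (fockState n)⟫_ℂ).re := by
      fun_prop
    exact (h3.tendsto _).comp h2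
  refine (le_of_tendsto_of_tendsto' hroot hfin hle).trans ?_
  gcongr
  exact hsum.sum_le_tsum s fun n _ => re_inner_nonneg hA0 _

end Semicontinuity

/-! ### Mixtures of subnormalised vectors as operators. -/

section Decomposition

variable {m : ℕ}

/-- Fock expansions converge in norm, so measurable coordinates suffice; this also handles maps that
are only weakly continuous. -/
lemma stronglyMeasurable_of_inner_fockState {α : Type*} [MeasurableSpace α] {f : α → FockSpace m}
    (hf : ∀ n, Measurable fun a => ⟪fockState n, f a⟫_ℂ) : StronglyMeasurable f := by
  refine stronglyMeasurable_of_tendsto (u := (atTop : Filter (Finset (Fin m → ℕ))))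
    (f := fun s a => ∑ n ∈ s, ⟪fockState n, f a⟫_ℂ • fockState n) (fun s => ?_) ?_
  · exact Finset.stronglyMeasurable_fun_sum s fun n _ => (hf n).stronglyMeasurable.smul_const _
  · rw [tendsto_pi_nhds]
    exact fun a => hasSum_inner_smul_fockState (f a)

lemma stronglyMeasurable_id_fockSpace : StronglyMeasurable (fun ψ : FockSpace m => ψ) :=
  stronglyMeasurable_of_inner_fockState fun n =>
    (show Continuous fun ψ : FockSpace m => ⟪fockState n, ψ⟫_ℂ by fun_prop).measurable

lemma continuous_inner_mul_inner (x y : FockSpace m) :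
    Continuous fun ψ : FockSpace m => ⟪x, ψ⟫_ℂ * ⟪ψ, y⟫_ℂ := by
  fun_prop

variable {μ : Measure (FockSpace m)}

lemma integrable_inner_mul_inner [IsProbabilityMeasure μ] (hμ : ∀ᵐ ψ ∂μ, ‖ψ‖ ≤ 1)
    (x y : FockSpace m) :
    Integrable (fun ψ => ⟪x, ψ⟫_ℂ * ⟪ψ, y⟫_ℂ) μ := by
  refine Integrable.of_bound (continuous_inner_mul_inner x y).measurable.aestronglyMeasurable
    (‖x‖ * ‖y‖) ?_
  filter_upwards [hμ] with ψ hψ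
  rw [norm_mul]
  calc _ ≤ (‖x‖ * ‖ψ‖) * (‖ψ‖ * ‖y‖) :=
        mul_le_mul (norm_inner_le_norm _ _) (norm_inner_le_norm _ _) (norm_nonneg _) (by positivity)
    _ ≤ (‖x‖ * 1) * (1 * ‖y‖) := by gcongr
    _ = _ := by ring

/-- The operator `∫ |ψ⟩⟨ψ| dμ(ψ)` of a probability measure on the unit ball. -/
lemma exists_inner_eq_integral [IsProbabilityMeasure μ] (hμ : ∀ᵐ ψ ∂μ, ‖ψ‖ ≤ 1) :
    ∃ T : FockOp m, ∀ x y : FockSpace m, ⟪x, T y⟫_ℂ = ∫ ψ, ⟪x, ψ⟫_ℂ * ⟪ψ, y⟫_ℂ ∂μ := by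
  have hcont : Continuous fun ψ : FockSpace m => InnerProductSpace.rankOne ℂ ψ ψ := by
    refine (((ContinuousLinearMap.smulRightL ℂ (FockSpace m) (FockSpace m)).continuous.comp
      (innerSL ℂ).continuous).clm_apply continuous_id).congr fun ψ => ?_
    ext1 x
    simp
  have hint : Integrable (fun ψ : FockSpace m => InnerProductSpace.rankOne ℂ ψ ψ) μ := by
    refine Integrable.of_bound
      (hcont.comp_stronglyMeasurable stronglyMeasurable_id_fockSpace).aestronglyMeasurable 1 ?_
    filter_upwards [hμ] with ψ hψ
    rw [InnerProductSpace.norm_rankOne]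
    exact mul_le_one₀ hψ (norm_nonneg _) hψ
  refine ⟨∫ ψ, InnerProductSpace.rankOne ℂ ψ ψ ∂μ, fun x y => ?_⟩
  have h := ContinuousLinearMap.integral_comp_comm
    ((innerSL ℂ x).comp (ContinuousLinearMap.apply ℂ (FockSpace m) y)) hint
  simp only [ContinuousLinearMap.comp_apply, ContinuousLinearMap.apply_apply, innerSL_apply_apply,
    InnerProductSpace.rankOne_apply, inner_smul_right] at h
  rw [← h]
  exact integral_congr_ae (Eventually.of_forall fun ψ => mul_comm _ _)

lemma inner_mul_inner_self (x ψ : FockSpace m) :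
    ⟪x, ψ⟫_ℂ * ⟪ψ, x⟫_ℂ = ((‖⟪x, ψ⟫_ℂ‖ ^ 2 : ℝ) : ℂ) := by
  rw [← inner_conj_symm ψ x, Complex.mul_conj, Complex.normSq_eq_norm_sq]

lemma integrable_norm_inner_sq [IsProbabilityMeasure μ] (hμ : ∀ᵐ ψ ∂μ, ‖ψ‖ ≤ 1) (x : FockSpace m) :
    Integrable (fun ψ => ‖⟪x, ψ⟫_ℂ‖ ^ 2) μ := by
  have := (integrable_inner_mul_inner hμ x x).re
  simpa only [inner_mul_inner_self, RCLike.re_to_complex, Complex.ofReal_re] using this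

lemma integrable_norm_sq [IsProbabilityMeasure μ] (hμ : ∀ᵐ ψ ∂μ, ‖ψ‖ ≤ 1) :
    Integrable (fun ψ => ‖ψ‖ ^ 2) μ := by
  refine Integrable.of_bound
    (show Continuous fun ψ : FockSpace m => ‖ψ‖ ^ 2 by fun_prop).measurable.aestronglyMeasurable
    1 ?_
  filter_upwards [hμ] with ψ hψ
  rw [Real.norm_eq_abs, abs_of_nonneg (by positivity)]
  exact pow_le_one₀ (norm_nonneg _) hψ

variable {T : FockOp m}

lemma inner_self_eq_integral (hT : ∀ x y, ⟪x, T y⟫_ℂ = ∫ ψ, ⟪x, ψ⟫_ℂ * ⟪ψ, y⟫_ℂ ∂μ)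
    (x : FockSpace m) : ⟪x, T x⟫_ℂ = ((∫ ψ, ‖⟪x, ψ⟫_ℂ‖ ^ 2 ∂μ : ℝ) : ℂ) := by
  rw [hT, ← integral_complex_ofReal]
  simp_rw [inner_mul_inner_self]

lemma isPositive_of_inner_eq_integral
    (hT : ∀ x y, ⟪x, T y⟫_ℂ = ∫ ψ, ⟪x, ψ⟫_ℂ * ⟪ψ, y⟫_ℂ ∂μ) : T.IsPositive := by
  rw [ContinuousLinearMap.isPositive_iff_complex]
  intro x
  have h : ⟪T x, x⟫_ℂ = ((∫ ψ, ‖⟪x, ψ⟫_ℂ‖ ^ 2 ∂μ : ℝ) : ℂ) := by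
    rw [← inner_conj_symm, inner_self_eq_integral hT, Complex.conj_ofReal]
  rw [h]
  exact ⟨rfl, integral_nonneg fun ψ => by positivity⟩

/-- Parseval under the integral sign: the trace of a mixture is the mean squared norm. -/
lemma hasSum_inner_of_inner_eq_integral [IsProbabilityMeasure μ] (hμ : ∀ᵐ ψ ∂μ, ‖ψ‖ ≤ 1)
    (hT : ∀ x y, ⟪x, T y⟫_ℂ = ∫ ψ, ⟪x, ψ⟫_ℂ * ⟪ψ, y⟫_ℂ ∂μ) :
    HasSum (fun n : Fin m → ℕ => ⟪fockState n, T (fockState n)⟫_ℂ)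
      ((∫ ψ, ‖ψ‖ ^ 2 ∂μ : ℝ) : ℂ) := by
  simp_rw [inner_self_eq_integral hT]
  have hint : ∀ n : Fin m → ℕ, Integrable (fun ψ => ‖⟪fockState n, ψ⟫_ℂ‖ ^ 2) μ :=
    fun n => integrable_norm_inner_sq hμ _
  have h := hasSum_integral_of_summable_integral_norm hint (by
    refine summable_of_sum_le (c := ∫ ψ, ‖ψ‖ ^ 2 ∂μ)
      (fun n => integral_nonneg fun ψ => norm_nonneg _) fun s => ?_
    rw [← integral_finsetSum s fun n _ => (hint n).norm]
    refine integral_mono (integrable_finsetSum s fun n _ => (hint n).norm)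
      (integrable_norm_sq hμ) fun ψ => ?_
    simp only [norm_pow, norm_norm]
    exact (orthonormal_fockState m).sum_inner_products_le ψ)
  simp_rw [(hasSum_norm_inner_fockState_sq _).tsum_eq] at h
  exact Complex.hasSum_ofReal.2 h

end Decomposition

/-! ### The weakly compact ball of bounded stellar rank. -/

section StellarRank

variable {m n : ℕ}

theorem IsPureDecomposition.isDensityOperator {μ : Measure (FockSpace m)} {τ : FockOp m}
    (h : IsPureDecomposition μ τ) : IsDensityOperator τ := by
  have := h.isProbabilityMeasure
  refine ⟨isPositive_of_inner_eq_integral h.inner_eq, ?_⟩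
  have h1 := hasSum_inner_of_inner_eq_integral (h.norm_eq_one.mono fun ψ hψ => hψ.le) h.inner_eq
  have h2 : ∫ ψ, ‖ψ‖ ^ 2 ∂μ = 1 := by
    rw [integral_congr_ae (g := fun _ => (1 : ℝ)) (h.norm_eq_one.mono fun ψ hψ => by
      simp [hψ])]
    simp
  rwa [h2, Complex.ofReal_one] at h1

lemma stellarRank_le_iff {τ : FockOp m} :
    stellarRank τ ≤ n ↔
      ∃ μ, IsPureDecomposition μ τ ∧ ∀ᵐ ψ ∂μ, pureStellarRank ψ ≤ n := by
  constructor
  · intro h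
    have h1 : stellarRank τ < ((n + 1 : ℕ) : ℕ∞) :=
      h.trans_lt (by exact_mod_cast Nat.lt_succ_self n)
    simp only [stellarRank, iInf_lt_iff] at h1
    obtain ⟨μ, hμ, hlt⟩ := h1
    refine ⟨μ, hμ, ?_⟩
    have h2 : essSup pureStellarRank μ ≤ n := by
      rw [Nat.cast_add, Nat.cast_one] at hlt
      exact ENat.lt_add_one_iff (ENat.natCast_ne_top n) |>.1 hlt
    filter_upwards [ae_le_essSup (f := pureStellarRank) (μ := μ)] with ψ hψ
    exact hψ.trans h2
  · rintro ⟨μ, hμ, hn⟩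
    exact (iInf₂_le μ hμ).trans (essSup_le_of_ae_le _ hn)

lemma pureStellarRank_smul_le (c : ℂ) (ψ : FockSpace m) :
    pureStellarRank (c • ψ) ≤ pureStellarRank ψ := by
  refine le_iInf₂ fun P hP => ?_
  obtain ⟨A, b, hA, h⟩ := hP
  have hcP : HasStellarPolynomial (c • ψ) (MvPolynomial.C c * P) := by
    refine ⟨A, b, hA, fun z => ?_⟩
    rw [stellarFunction_eq_inner, inner_smul_right, ← stellarFunction_eq_inner, h, map_mul,
      MvPolynomial.eval_C, mul_assoc]
  refine (iInf₂_le _ hcP).trans ?_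
  have := MvPolynomial.totalDegree_mul (MvPolynomial.C c) P
  rw [MvPolynomial.totalDegree_C, zero_add] at this
  exact_mod_cast this

lemma pureStellarRank_zero : pureStellarRank (0 : FockSpace m) = 0 := by
  refine le_antisymm ((pureStellarRank_le_iff (n := 0)).2 ⟨0, ⟨0, 0, by simp [Matrix.IsSymm],
    fun z => ?_⟩, by simp⟩) (zero_le)
  rw [stellarFunction_eq_inner, inner_zero_right]; simp

/-- The unit ball vectors of stellar rank at most `n`, with the weak topology. -/
structure StellarBall (m n : ℕ) where
  /-- The underlying vector. -/
  toFock : FockSpace m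
  norm_le_one : ‖toFock‖ ≤ 1
  rank_le : pureStellarRank toFock ≤ n

namespace StellarBall

/-- The inner products of a vector, as an element of a product space. -/
def inners (ψ : StellarBall m n) (y : FockSpace m) : ℂ := ⟪ψ.toFock, y⟫_ℂ

instance : TopologicalSpace (StellarBall m n) := .induced inners inferInstance

instance : MeasurableSpace (StellarBall m n) := borel _

instance : BorelSpace (StellarBall m n) := ⟨rfl⟩

lemma continuous_inner (y : FockSpace m) :
    Continuous fun ψ : StellarBall m n => ⟪ψ.toFock, y⟫_ℂ :=
  (continuous_apply y).comp continuous_induced_dom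

lemma continuous_inner' (y : FockSpace m) :
    Continuous fun ψ : StellarBall m n => ⟪y, ψ.toFock⟫_ℂ := by
  have := Complex.continuous_conj.comp (continuous_inner (n := n) y)
  simpa only [Function.comp_def, inner_conj_symm] using this

lemma inners_injective : Function.Injective (inners (m := m) (n := n)) := by
  rintro ⟨ψ, h1, h2⟩ ⟨φ, h3, h4⟩ h
  obtain rfl : ψ = φ := ext_inner_right ℂ fun y => congr_fun h y
  rfl

instance : T2Space (StellarBall m n) :=
  (Topology.IsEmbedding.mk ⟨rfl⟩ inners_injective).t2Space

/-- Banach–Alaoglu, transported by Riesz duality, gives a weak limit in the unit ball; closedness of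
the rank bound keeps it in the set. -/
instance : CompactSpace (StellarBall m n) := by
  refine ⟨isCompact_iff_ultrafilter_le_nhds.2 fun U _ => ?_⟩
  obtain ⟨L, hL, hUL⟩ := (WeakDual.isCompact_closedBall (𝕜 := ℂ) (E := FockSpace m) 0
    1).ultrafilter_le_nhds
    (U.map fun ψ => StrongDual.toWeakDual (InnerProductSpace.toDual ℂ _ ψ.toFock)) (by
      rw [le_principal_iff, Ultrafilter.coe_map, mem_map]
      refine Eventually.of_forall fun ψ => ?_
      change InnerProductSpace.toDual ℂ _ ψ.toFock ∈ closedBall _ _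
      rw [mem_closedBall_zero_iff, LinearIsometryEquiv.norm_map]
      exact ψ.norm_le_one)
  set ψ₀ := (InnerProductSpace.toDual ℂ (FockSpace m)).symm (WeakDual.toStrongDual L) with hψ₀
  have hlim : ∀ y, Tendsto (fun ψ : StellarBall m n => ⟪ψ.toFock, y⟫_ℂ) U (𝓝 ⟪ψ₀, y⟫_ℂ) := by
    intro y
    have h1 := ((WeakDual.eval_continuous y).tendsto L).comp hUL
    rw [hψ₀, InnerProductSpace.toDual_symm_apply]
    exact h1
  have hn : ‖ψ₀‖ ≤ 1 := by
    rw [hψ₀, LinearIsometryEquiv.norm_map]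
    simpa using hL
  have hr := pureStellarRank_le_of_tendsto U norm_le_one rank_le hlim
  refine ⟨⟨ψ₀, hn, hr⟩, Set.mem_univ _, ?_⟩
  rw [show 𝓝 (⟨ψ₀, hn, hr⟩ : StellarBall m n) = comap inners (𝓝 (fun y => ⟪ψ₀, y⟫_ℂ)) from
    nhds_induced _ _, ← map_le_iff_le_comap]
  exact tendsto_pi_nhds.2 hlim

lemma measurable_toFock : Measurable (toFock (m := m) (n := n)) :=
  (stronglyMeasurable_of_inner_fockState fun _ => (continuous_inner' _).measurable).measurable

/-- Norm convergence implies weak convergence. Closedness is what makes the rank condition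
measurable. -/
lemma isClosed_range_toFock : IsClosed {ψ : FockSpace m | ‖ψ‖ ≤ 1 ∧ pureStellarRank ψ ≤ n} := by
  rw [isClosed_iff_ultrafilter]
  intro ψ U hU hmem
  rw [← Ultrafilter.mem_coe] at hmem
  have hc : IsClosed {ψ : FockSpace m | ‖ψ‖ ≤ 1} := isClosed_le continuous_norm continuous_const
  refine ⟨hc.mem_of_tendsto (X := FockSpace m) (f := id) (b := (U : Filter (FockSpace m))) hU
    (mem_of_superset hmem fun φ hφ => hφ.1), ?_⟩
  classical
  -- The closure result asks for its bounds at every index, so indices outside the set are sent to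
  -- `0`, which has norm and rank `0`.
  refine pureStellarRank_le_of_tendsto U (φ := fun φ =>
    if ‖φ‖ ≤ 1 ∧ pureStellarRank φ ≤ n then φ else 0) (fun φ => ?_) (fun φ => ?_) fun y => ?_
  · split_ifs with h
    · exact h.1
    · simp
  · split_ifs with h
    · exact h.2
    · simp [pureStellarRank_zero]
  · have h1 : Tendsto (fun φ : FockSpace m => ⟪φ, y⟫_ℂ) U (𝓝 ⟪ψ, y⟫_ℂ) :=
      ((show Continuous fun φ : FockSpace m => ⟪φ, y⟫_ℂ by fun_prop).tendsto ψ).mono_left hU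
    refine h1.congr' ?_
    filter_upwards [hmem] with φ hφ
    rw [if_pos hφ]

open Classical in
/-- A retraction of the Fock space onto the stellar ball. -/
def ofFock (m n : ℕ) (ψ : FockSpace m) : StellarBall m n :=
  if h : ψ ∈ {ψ : FockSpace m | ‖ψ‖ ≤ 1 ∧ pureStellarRank ψ ≤ n} then ⟨ψ, h.1, h.2⟩
  else ⟨0, by simp, by simp [pureStellarRank_zero]⟩

lemma measurable_ofFock : Measurable (ofFock m n) := by
  classical
  have hf : Measurable fun ψ : {ψ : FockSpace m | ‖ψ‖ ≤ 1 ∧ pureStellarRank ψ ≤ n} =>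
      (⟨ψ.1, ψ.2.1, ψ.2.2⟩ : StellarBall m n) := by
    refine Continuous.measurable (continuous_induced_rng.2 (continuous_pi fun y => ?_))
    exact (show Continuous fun φ : FockSpace m => ⟪φ, y⟫_ℂ by fun_prop).comp
      continuous_subtype_val
  exact Measurable.dite hf (g := fun _ => ⟨0, by simp, by simp [pureStellarRank_zero]⟩)
    measurable_const isClosed_range_toFock.measurableSet

lemma toFock_ofFock {ψ : FockSpace m} (h1 : ‖ψ‖ ≤ 1) (h2 : pureStellarRank ψ ≤ n) :
    (ofFock m n ψ).toFock = ψ := by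
  have h : ψ ∈ {ψ : FockSpace m | ‖ψ‖ ≤ 1 ∧ pureStellarRank ψ ≤ n} := ⟨h1, h2⟩
  rw [ofFock, dif_pos h]

end StellarBall

end StellarRank

/-! ### Attainment of the stellar fidelity and the equivalence. -/

section Attainment

variable {m n : ℕ} {ρ : FockOp m}

/-- A mixture of subnormalised vectors of stellar rank at most `n` is a multiple of a state of
stellar rank at most `n`. -/
lemma exists_density_smul_eq {μ : Measure (FockSpace m)} [IsProbabilityMeasure μ]
    (hμ : ∀ᵐ ψ ∂μ, ‖ψ‖ ≤ 1 ∧ pureStellarRank ψ ≤ n) {T : FockOp m}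
    (hT : ∀ x y, ⟪x, T y⟫_ℂ = ∫ ψ, ⟪x, ψ⟫_ℂ * ⟪ψ, y⟫_ℂ ∂μ) (ht : 0 < ∫ ψ, ‖ψ‖ ^ 2 ∂μ) :
    ∃ σ : FockOp m, IsDensityOperator σ ∧ stellarRank σ ≤ n ∧
      T = ((∫ ψ, ‖ψ‖ ^ 2 ∂μ : ℝ) : ℂ) • σ := by
  set t := ∫ ψ, ‖ψ‖ ^ 2 ∂μ with htdef
  have hint := integrable_norm_sq (hμ.mono fun ψ h => h.1)
  -- Weight by `‖ψ‖² / t`, then normalise each vector: `|ψ⟩⟨ψ| / t` is unchanged, and zero vectors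
  -- receive no weight.
  set w : FockSpace m → ENNReal := fun ψ => ENNReal.ofReal (‖ψ‖ ^ 2 / t) with hw
  have hwm : Measurable w :=
    (show Continuous fun ψ : FockSpace m => ‖ψ‖ ^ 2 / t by fun_prop).measurable.ennreal_ofReal
  set N : FockSpace m → FockSpace m := fun ψ => ((‖ψ‖⁻¹ : ℝ) : ℂ) • ψ with hN
  have hNm : Measurable N := by
    have h : Measurable fun ψ : FockSpace m => ((‖ψ‖⁻¹ : ℝ) : ℂ) :=
      Complex.measurable_ofReal.comp measurable_norm.inv
    exact (h.stronglyMeasurable.fun_smul stronglyMeasurable_id_fockSpace).measurable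
  set ν := (μ.withDensity w).map N with hν
  have hmass : (μ.withDensity w) Set.univ = 1 := by
    rw [withDensity_apply _ MeasurableSet.univ, Measure.restrict_univ,
      ← ofReal_integral_eq_lintegral_ofReal (hint.div_const t)
        (Eventually.of_forall fun ψ => by positivity), integral_div, ← htdef, div_self ht.ne',
      ENNReal.ofReal_one]
  have hprob : IsProbabilityMeasure ν := ⟨by
    rw [hν, Measure.map_apply hNm MeasurableSet.univ, Set.preimage_univ, hmass]⟩
  have hνn : ∀ᵐ ψ ∂ν, ‖ψ‖ = 1 ∧ ‖ψ‖ ≤ 1 ∧ pureStellarRank ψ ≤ n := by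
    have hms : MeasurableSet {ψ : FockSpace m | ‖ψ‖ = 1 ∧ ‖ψ‖ ≤ 1 ∧ pureStellarRank ψ ≤ n} :=
      (measurableSet_eq_fun measurable_norm measurable_const).inter
        StellarBall.isClosed_range_toFock.measurableSet
    rw [hν, ae_map_iff hNm.aemeasurable hms, ae_withDensity_iff hwm]
    filter_upwards [hμ] with ψ hψ h0
    have hψ0 : ‖ψ‖ ≠ 0 := by
      intro h
      simp [hw, h] at h0
    have h1 : ‖N ψ‖ = 1 := by
      rw [hN, norm_smul, Complex.norm_real, Real.norm_eq_abs, abs_of_nonneg (by positivity),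
        inv_mul_cancel₀ hψ0]
    exact ⟨h1, h1.le, (pureStellarRank_smul_le _ _).trans hψ.2⟩
  have hdec : IsPureDecomposition ν (((t⁻¹ : ℝ) : ℂ) • T) := by
    refine ⟨hprob, hνn.mono fun ψ h => h.1, fun x y => ?_⟩
    rw [hν, integral_map hNm.aemeasurable
      (continuous_inner_mul_inner x y).measurable.aestronglyMeasurable,
      integral_withDensity_eq_integral_toReal_smul hwm
        (Eventually.of_forall fun ψ => ENNReal.ofReal_lt_top), smul_apply, inner_smul_right, hT,
      ← integral_const_mul]
    refine integral_congr_ae (Eventually.of_forall fun ψ => ?_)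
    simp only [hw, hN]
    rw [ENNReal.toReal_ofReal (by positivity), inner_smul_left, inner_smul_right,
      Complex.conj_ofReal, Complex.real_smul]
    by_cases h : ψ = 0
    · simp [h]
    · have h0 : (‖ψ‖ : ℂ) ≠ 0 := by exact_mod_cast norm_ne_zero_iff.2 h
      push_cast
      field_simp
  refine ⟨_, hdec.isDensityOperator, stellarRank_le_iff.2 ⟨ν, hdec, hνn.mono fun ψ h => h.2.2⟩,
    ?_⟩
  rw [smul_smul, ← Complex.ofReal_mul, mul_inv_cancel₀ ht.ne', Complex.ofReal_one, one_smul]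

lemma eq_zero_of_integral_norm_sq_eq_zero {μ : Measure (FockSpace m)} [IsProbabilityMeasure μ]
    (hμ : ∀ᵐ ψ ∂μ, ‖ψ‖ ≤ 1) {T : FockOp m}
    (hT : ∀ x y, ⟪x, T y⟫_ℂ = ∫ ψ, ⟪x, ψ⟫_ℂ * ⟪ψ, y⟫_ℂ ∂μ) (ht : ∫ ψ, ‖ψ‖ ^ 2 ∂μ = 0) :
    T = 0 := by
  rw [integral_eq_zero_iff_of_nonneg (fun ψ => by positivity) (integrable_norm_sq hμ)] at ht
  ext1 y
  refine ext_inner_left ℂ fun x => ?_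
  rw [hT, zero_apply, inner_zero_right]
  refine integral_eq_zero_of_ae ?_
  filter_upwards [ht] with ψ hψ
  have : ψ = 0 := by simpa using hψ
  simp [this]

/-- Fidelities with states of stellar rank at most `n` attain their limits. -/
theorem exists_le_fidelity_of_tendsto (hρ : IsDensityOperator ρ) {τ : ℕ → FockOp m}
    (hr : ∀ k, stellarRank (τ k) ≤ n) {f : ℝ} (hf0 : 0 < f)
    (hf : Tendsto (fun k => fidelity ρ (τ k)) atTop (𝓝 f)) :
    ∃ σ : FockOp m, IsDensityOperator σ ∧ stellarRank σ ≤ n ∧ f ≤ fidelity ρ σ := by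
  choose μ hμ hμr using fun k => stellarRank_le_iff.1 (hr k)
  have hprob : ∀ k, IsProbabilityMeasure (μ k) := fun k => (hμ k).isProbabilityMeasure
  -- Almost every vector of each decomposition lies in the stellar ball, so the default value of
  -- `ofFock` is never seen.
  let ν : ℕ → ProbabilityMeasure (StellarBall m n) := fun k =>
    ⟨(μ k).map (StellarBall.ofFock m n),
      Measure.isProbabilityMeasure_map StellarBall.measurable_ofFock.aemeasurable⟩
  let U : Ultrafilter ℕ := hyperfilter ℕ
  obtain ⟨ν₀, -, hν₀⟩ := isCompact_univ.ultrafilter_le_nhds (U.map ν) (by simp)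
  have hν : Tendsto ν U (𝓝 ν₀) := hν₀
  set κ : Measure (FockSpace m) := (ν₀ : Measure (StellarBall m n)).map StellarBall.toFock with hκ
  have hκp : IsProbabilityMeasure κ :=
    Measure.isProbabilityMeasure_map StellarBall.measurable_toFock.aemeasurable
  have hκn : ∀ᵐ ψ ∂κ, ‖ψ‖ ≤ 1 ∧ pureStellarRank ψ ≤ n := by
    rw [hκ, ae_map_iff StellarBall.measurable_toFock.aemeasurable
      StellarBall.isClosed_range_toFock.measurableSet]
    exact Eventually.of_forall fun ψ => ⟨ψ.norm_le_one, ψ.rank_le⟩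
  have hκ1 : ∀ᵐ ψ ∂κ, ‖ψ‖ ≤ 1 := hκn.mono fun ψ h => h.1
  obtain ⟨T, hT⟩ := exists_inner_eq_integral hκ1
  have hlim : ∀ x y, Tendsto (fun k => ⟪x, τ k y⟫_ℂ) U (𝓝 ⟪x, T y⟫_ℂ) := by
    intro x y
    -- The integrand is weakly continuous, hence bounded on the compact ball. The squared norm is
    -- not covered by this, which is how mass can be lost.
    have h := (ProbabilityMeasure.tendsto_iff_forall_integral_rclike_tendsto ℂ).1 hν
      (BoundedContinuousFunction.mkOfCompact ⟨fun ψ => ⟪x, ψ.toFock⟫_ℂ * ⟪ψ.toFock, y⟫_ℂ,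
        (StellarBall.continuous_inner' x).mul (StellarBall.continuous_inner y)⟩)
    simp only [BoundedContinuousFunction.mkOfCompact_apply, ContinuousMap.coe_mk] at h
    rw [hT, hκ, integral_map StellarBall.measurable_toFock.aemeasurable
      (continuous_inner_mul_inner x y).measurable.aestronglyMeasurable]
    refine h.congr fun k => ?_
    rw [(hμ k).inner_eq]
    change ∫ ψ, ⟪x, ψ.toFock⟫_ℂ * ⟪ψ.toFock, y⟫_ℂ ∂((μ k).map (StellarBall.ofFock m n)) = _
    rw [integral_map StellarBall.measurable_ofFock.aemeasurable
      ((StellarBall.continuous_inner' x).fun_mul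
        (StellarBall.continuous_inner y)).measurable.aestronglyMeasurable]
    refine integral_congr_ae ?_
    filter_upwards [hμr k, (hμ k).norm_eq_one] with ψ h1 h2
    rw [StellarBall.toFock_ofFock h2.le h1]
  have hfU : Tendsto (fun k => fidelity ρ (τ k)) U (𝓝 f) :=
    hf.mono_left Nat.hyperfilter_le_atTop
  have hτ := fun k => (hμ k).isDensityOperator
  set t := ∫ ψ, ‖ψ‖ ^ 2 ∂κ with ht
  have ht0 : 0 ≤ t := integral_nonneg fun ψ => by positivity
  have ht1 : t ≤ 1 := by
    have h := integral_mono_ae (integrable_norm_sq hκ1) (integrable_const (1 : ℝ))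
      (hκ1.mono fun ψ h => pow_le_one₀ (norm_nonneg _) h)
    simpa using h
  rcases ht0.eq_or_lt with h0 | hpos
  · have hT0 := eq_zero_of_integral_norm_sq_eq_zero hκ1 hT h0.symm
    have := le_mul_fidelity_of_tendsto (l := (U : Filter ℕ)) hρ hρ hτ le_rfl zero_le_one
      (fun a b => by simpa [hT0] using hlim (fockState a) (fockState b)) hfU
    linarith
  · obtain ⟨σ, hσ, hσn, hTσ⟩ := exists_density_smul_eq hκn hT hpos
    refine ⟨σ, hσ, hσn, ?_⟩
    have := le_mul_fidelity_of_tendsto (l := (U : Filter ℕ)) hρ hσ hτ ht0 ht1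
      (fun a b => by rw [← hTσ]; exact hlim (fockState a) (fockState b)) hfU
    exact this.trans (mul_le_of_le_one_left (fidelity_nonneg _ _) ht1)

lemma pureStellarRank_fockState_zero : pureStellarRank (fockState (0 : Fin m → ℕ)) = 0 := by
  refine le_antisymm ((pureStellarRank_le_iff (n := 0)).2 ⟨1, ⟨0, 0, by simp [Matrix.IsSymm],
    fun z => ?_⟩, by simp⟩) zero_le
  rw [stellarFunction, tsum_eq_single 0 fun k hk => by
    rw [(orthonormal_fockState m).2 hk, zero_div, zero_mul]]
  rw [inner_self_eq_norm_sq_to_K, norm_fockState]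
  simp [gaussianFunction]

/-- The vacuum shows that the set under the supremum is nonempty. -/
lemma exists_density_stellarRank_eq_zero (m : ℕ) :
    ∃ σ : FockOp m, IsDensityOperator σ ∧ stellarRank σ ≤ (0 : ℕ) := by
  set e : FockSpace m := fockState 0
  have hdec : IsPureDecomposition (Measure.dirac e) (InnerProductSpace.rankOne ℂ e e) := by
    refine ⟨inferInstance, ?_, fun x y => ?_⟩
    · rw [ae_dirac_iff (measurableSet_eq_fun measurable_norm measurable_const)]
      exact norm_fockState _
    · rw [integral_dirac, InnerProductSpace.rankOne_apply, inner_smul_right, mul_comm]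
  refine ⟨_, hdec.isDensityOperator, stellarRank_le_iff.2 ⟨_, hdec, ?_⟩⟩
  rw [ae_dirac_eq]
  exact pureStellarRank_fockState_zero.le

theorem fidelity_le_stellarFidelity (hρ : IsDensityOperator ρ) {σ : FockOp m}
    (hσ : IsDensityOperator σ) (hn : stellarRank σ ≤ n) : fidelity ρ σ ≤ stellarFidelity n ρ :=
  le_csSup ⟨1, by rintro _ ⟨τ, hτ, -, rfl⟩; exact fidelity_le_one hρ hτ⟩ ⟨σ, hσ, hn, rfl⟩

/-- The supremum defining the stellar fidelity is attained. -/
theorem exists_fidelity_eq_stellarFidelity (hρ : IsDensityOperator ρ) (n : ℕ) :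
    ∃ σ : FockOp m, IsDensityOperator σ ∧ stellarRank σ ≤ n ∧
      fidelity ρ σ = stellarFidelity n ρ := by
  obtain ⟨σ₀, hσ₀, hn₀⟩ := exists_density_stellarRank_eq_zero m
  replace hn₀ : stellarRank σ₀ ≤ n := hn₀.trans (by exact_mod_cast n.zero_le)
  have h0 : 0 ≤ stellarFidelity n ρ :=
    (fidelity_nonneg _ _).trans (fidelity_le_stellarFidelity hρ hσ₀ hn₀)
  -- If the supremum is `0`, the vacuum attains it; otherwise it is positive, as the limit argument
  -- requires.
  rcases h0.eq_or_lt with h | hpos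
  · exact ⟨σ₀, hσ₀, hn₀, le_antisymm (fidelity_le_stellarFidelity hρ hσ₀ hn₀)
      (h ▸ fidelity_nonneg _ _)⟩
  · obtain ⟨u, -, hu, hmem⟩ := exists_seq_tendsto_sSup
      (S := {x : ℝ | ∃ τ : FockOp m, IsDensityOperator τ ∧ stellarRank τ ≤ n ∧ fidelity ρ τ = x})
      ⟨_, σ₀, hσ₀, hn₀, rfl⟩
      ⟨1, by rintro _ ⟨τ, hτ, -, rfl⟩; exact fidelity_le_one hρ hτ⟩
    choose τ _ hτn hτf using hmem
    obtain ⟨σ, hσ, hσn, hle⟩ := exists_le_fidelity_of_tendsto hρ hτn hpos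
      (hu.congr fun k => (hτf k).symm)
    exact ⟨σ, hσ, hσn, le_antisymm (fidelity_le_stellarFidelity hρ hσ hσn) hle⟩

/-- An infimum in `ℕ∞` below `n + 1` has a witness, giving one direction. The other needs
attainment: a mere supremum would miss the endpoint `1 - ε = stellarFidelity n ρ`. -/
theorem approxStellarRank_le_iff (hρ : IsDensityOperator ρ) (n : ℕ) (ε : ℝ) :
    approxStellarRank ε ρ ≤ n ↔ 1 - ε ≤ stellarFidelity n ρ := by
  constructor
  · intro h
    have h1 : approxStellarRank ε ρ < ((n + 1 : ℕ) : ℕ∞) :=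
      h.trans_lt (by exact_mod_cast Nat.lt_succ_self n)
    simp only [approxStellarRank, iInf_lt_iff] at h1
    obtain ⟨τ, ⟨hτ, hF⟩, hlt⟩ := h1
    rw [Nat.cast_add, Nat.cast_one, ENat.lt_add_one_iff (ENat.natCast_ne_top n)] at hlt
    exact hF.trans (fidelity_le_stellarFidelity hρ hτ hlt)
  · intro h
    obtain ⟨σ, hσ, hσn, hF⟩ := exists_fidelity_eq_stellarFidelity hρ n
    exact (iInf₂_le σ ⟨hσ, hF ▸ h⟩).trans hσn

theorem approxStellarRank_le_stellarRank (hρ : IsDensityOperator ρ) {ε : ℝ} (hε : 0 ≤ ε) :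
    approxStellarRank ε ρ ≤ stellarRank ρ :=
  iInf₂_le ρ ⟨hρ, by rw [fidelity_self hρ]; linarith⟩

lemma ENat.eq_natCast_iff_le_and_not_le_pred {a : ℕ∞} (hn : 1 ≤ n) :
    a = n ↔ a ≤ n ∧ ¬ a ≤ (n - 1 : ℕ) := by
  induction a using ENat.recTopCoe with
  | top => simp
  | coe a =>
    simp only [Nat.cast_le, Nat.cast_inj]
    omega

end Attainment

end

theorem mainTheorem6 (m : ℕ) (ρ : FockOp m) (hρ : IsDensityOperator ρ) :
    (∀ (n : ℕ) (ε : ℝ), ε ∈ Set.Icc (0 : ℝ) 1 →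
      (approxStellarRank ε ρ ≤ (n : ℕ∞) ↔ 1 - ε ≤ stellarFidelity n ρ)) ∧
    (∀ (N : ℕ) (ε : ℝ), ε ∈ Set.Icc (0 : ℝ) 1 → 1 ≤ N → stellarRank ρ = (N : ℕ∞) →
      (approxStellarRank ε ρ = stellarRank ρ ↔
        ε ∈ Set.Ico (0 : ℝ) (1 - stellarFidelity (N - 1) ρ))) ∧
    (∀ (n : ℕ) (ε : ℝ), ε ∈ Set.Icc (0 : ℝ) 1 → 1 ≤ n →
      (approxStellarRank ε ρ = (n : ℕ∞) ↔
        ε ∈ Set.Ico (1 - stellarFidelity n ρ) (1 - stellarFidelity (n - 1) ρ))) ∧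
    (∀ ε : ℝ, ε ∈ Set.Icc (0 : ℝ) 1 →
      (approxStellarRank ε ρ = 0 ↔ ε ∈ Set.Icc (1 - stellarFidelity 0 ρ) 1)) := by
  refine ⟨fun n ε _ => approxStellarRank_le_iff hρ n ε, fun N ε hε hN hr => ?_,
    fun n ε _ hn => ?_, fun ε hε => ?_⟩
  -- `ρ` competes in its own infimum, so only the failure of rank `N - 1` remains to be
  -- characterised.
  · have hle := hr ▸ approxStellarRank_le_stellarRank hρ hε.1
    rw [hr, ENat.eq_natCast_iff_le_and_not_le_pred hN, approxStellarRank_le_iff hρ (N - 1),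
      and_iff_right hle, Set.mem_Ico, and_iff_right hε.1, not_le]
    constructor <;> intro h <;> linarith
  · rw [ENat.eq_natCast_iff_le_and_not_le_pred hn, approxStellarRank_le_iff hρ,
      approxStellarRank_le_iff hρ, Set.mem_Ico, not_le]
    constructor <;> rintro ⟨h1, h2⟩ <;> constructor <;> linarith
  · have h := approxStellarRank_le_iff hρ 0 ε
    rw [Nat.cast_zero, nonpos_iff_eq_zero] at h
    rw [h, Set.mem_Icc, and_iff_left hε.2]
    constructor <;> intro h <;> linarith
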